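/- Let $X$ be a Polish space with Borel sigma-algebra $\mathcal{B}_X$, let $T,d,\tilde d$ be non-negative integers, and let $S=(S_t)_{0\le t\le T}$ and $Y=(Y_t)_{0\le t\le T}$ be Borel measurable processes on $X$ with values in $\mathbb{R}^d$ and $\mathbb{R}^{\tilde d}$. Let $\mathcal{F}^{S,Y}_t=\sigma(S_u,Y_u : u\le t)$ and $\Delta S_t=S_t-S_{t-1}$. For a Polish space $Z$, let $\Sigma^1_1(Z)$ be the class of analytic subsets of $Z$, let $\Sigma^1_{n+1}(Z)$ be the class of projections to $Z$ of the sets $B\subseteq Z\times\mathbb{N}^{\mathbb{N}}$ whose complement is in $\Sigma^1_n(Z\times\mathbb{N}^{\mathbb{N}})$, and call the sets in $\bigcup_{n\ge 1}\Sigma^1_n(Z)$ projective. Let $\mathcal{F}^{pr,n}_t$ be the sigma-algebra on $X$ generated by the preimages, under the trajectory map $\omega\mapsto (S_u(\omega),Y_u(\omega))_{0\le u\le t}$, of the $\Sigma^1_n$ subsets of $(\mathbb{R}^d\times\mathbb{R}^{\tilde d})^{t+1}$. For $\Omega\subseteq X$ let $\mathcal{M}_\Omega$ be the set of Borel probability measures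 $Q$ on $X$ with $Q(\Omega)=1$ (with respect to the completion of $Q$) under which $S$ is a martingale for $(\mathcal{F}^{S,Y}_t)_t$, let $\mathcal{M}^f_\Omega$ be the set of those $Q\in\mathcal{M}_\Omega$ whose support is finite, and let $$\Omega^*=\{\omega\in\Omega : Q(\{\omega\})>0 \text{ for some } Q\in\mathcal{M}^f_\Omega\}.$$ For $t\in\{1,\dots,T\}$ and $\Gamma\subseteq X$, a conditional splitting of $\Gamma$ at time $t$ consists of integers $n\ge 1$ and $\beta\in\{0,\dots,d\}$, of $\mathcal{F}^{pr,n}_{t-1}$-measurable maps $H^1,\dots,H^\beta:X\to\mathbb{R}^d$, and of sets $E^0,\dots,E^\beta\in\mathcal{F}^{pr,n}_t$ such that the sets $B^i=E^i\cap\Gamma$, $0\le i\le\beta$, are pairwise disjoint with union $\Gamma$, and 1. for $1\le i\le\beta$: $B^i\ne\emptyset$, $H^i\cdot\Delta S_t>0$ on $B^i$, and $H^i\cdot\Delta S_t\ge 0$ on $B^i\cup B^{i+1}\cup\dots\cup B^\beta\cup B^0$; 2. every $\mathcal{F}^{pr,n}_{t-1}$-measurable $H:X\to\mathbb{R}^d$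 with $H\cdot\Delta S_t\ge 0$ on $B^0$ satisfies $H\cdot\Delta S_t=0$ on $B^0$. A backward conditional-splitting scheme from $\Omega$ is a sequence $\Omega_T,\Omega_{T-1},\dots,\Omega_0$ of subsets of $X$ with $\Omega_T=\Omega$ and, for every $t\in\{1,\dots,T\}$, $\Omega_{t-1}=\Omega_t\setminus\bigcup_{i=1}^{\beta}B^i$ for some conditional splitting of $\Omega_t$ at time $t$. Let $\Omega\subseteq X$ be projective. Then there is a backward conditional-splitting scheme from $\Omega$, and every such scheme satisfies $\Omega_0=\Omega^*$; moreover, $\Omega^*$ is projective. If $\Omega$ is analytic, then $\Omega^*$ is analytic and $$\Omega^*\neq\emptyset \iff \mathcal{M}_\Omega\neq\emptyset \iff \mathcal{M}^f_\Omega\neq\emptyset .$$ -/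

import Mathlib

open MeasureTheory

universe u

/-- The boldface projective class `Σ¹_{n+1}` of subsets of a topological space `X` (meant for Polish
`X`): `Σ¹₁` is the class of analytic sets, and `Σ¹_{n+2}` is the class of projections to `X` of the
`Π¹_{n+1}` subsets of `X × ℕ^ℕ`, that is, of the sets whose complement is in `Σ¹_{n+1}`. Thus the
index is shifted by one: the argument `n` stands for the level `n + 1`. -/
def SigmaClass : ℕ → (X : Type u) → [TopologicalSpace X] → Set (Set X)
  | 0, _, _ => {A | AnalyticSet A}
  | n + 1, X, _ => {A | ∃ B : Set (X × (ℕ → ℕ)), Bᶜ ∈ SigmaClass n (X × (ℕ → ℕ)) ∧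
      A = Prod.fst '' B}

/-- Projective sets: the union of the classes `Σ¹_n`, `n ≥ 1`. -/
def IsProjective {X : Type u} [TopologicalSpace X] (A : Set X) : Prop :=
  ∃ n : ℕ, A ∈ SigmaClass n X

/-- A discrete time market on `X` with times `0, …, T`: discounted prices `S` of `d` traded assets
and a process `Y` of `e` non-traded factors, both Borel measurable. -/
structure Market (X : Type u) [MeasurableSpace X] (T d e : ℕ) where
  /-- the price process -/
  S : Fin (T + 1) → X → EuclideanSpace ℝ (Fin d)
  /-- the factor process -/
  Y : Fin (T + 1) → X → EuclideanSpace ℝ (Fin e)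
  measurable_S : ∀ t, Measurable (S t)
  measurable_Y : ∀ t, Measurable (Y t)

namespace Market

variable {X : Type u} [MeasurableSpace X] {T d e : ℕ}

/-- The pair process `(S, Y)`. -/
def pair (M : Market X T d e) (t : Fin (T + 1)) (ω : X) :
    EuclideanSpace ℝ (Fin d) × EuclideanSpace ℝ (Fin e) :=
  (M.S t ω, M.Y t ω)

theorem measurable_pair (M : Market X T d e) (t : Fin (T + 1)) : Measurable (M.pair t) :=
  (M.measurable_S t).prodMk (M.measurable_Y t)

/-- The natural filtration of `(S, Y)`. -/
noncomputable def filtration (M : Market X T d e) :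
    Filtration (Fin (T + 1)) (inferInstance : MeasurableSpace X) :=
  Filtration.natural M.pair fun t => (M.measurable_pair t).stronglyMeasurable

/-- The martingale measures concentrated on `Ω`: Borel probability measures `Q` under which `S` is a
martingale for the natural filtration of `(S, Y)` and `Q(Ω) = 1`. As `Ω` need not be Borel, `Q(Ω) = 1`
is understood for the completion of `Q`: the complement of `Ω` is contained in a Borel `Q`-null
set. -/
def martingaleMeasures (M : Market X T d e) (Ω : Set X) : Set (Measure X) :=
  {Q | IsProbabilityMeasure Q ∧ Martingale M.S M.filtration Q ∧ Q Ωᶜ = 0}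

/-- The martingale measures concentrated on `Ω` that have finite support. -/
def finMartingaleMeasures [TopologicalSpace X] (M : Market X T d e) (Ω : Set X) :
    Set (Measure X) :=
  {Q | Q ∈ M.martingaleMeasures Ω ∧ Q.support.Finite}

/-- `Ω*`: the scenarios in `Ω` charged by a finitely supported martingale measure on `Ω`. -/
def star [TopologicalSpace X] (M : Market X T d e) (Ω : Set X) : Set X :=
  {ω | ω ∈ Ω ∧ ∃ Q ∈ M.finMartingaleMeasures Ω, 0 < Q {ω}}

/-- The trajectory of `(S, Y)` up to time `t`. -/
def traj (M : Market X T d e) (t : Fin (T + 1)) (ω : X) :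
    Set.Iic t → EuclideanSpace ℝ (Fin d) × EuclideanSpace ℝ (Fin e) :=
  fun r => M.pair r.1 ω

/-- The sigma-algebra `F^{pr,n+1}_t` generated by the preimages of the `Σ¹_{n+1}` subsets of the
space of trajectories up to time `t` (index shift as in `SigmaClass`). -/
abbrev projAlgebra (M : Market X T d e) (n : ℕ) (t : Fin (T + 1)) : MeasurableSpace X :=
  MeasurableSpace.generateFrom {A | ∃ L ∈ SigmaClass n
    (Set.Iic t → EuclideanSpace ℝ (Fin d) × EuclideanSpace ℝ (Fin e)), A = M.traj t ⁻¹' L}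

/-- The price increment over the `t`-th period, from time `t` to time `t + 1`. -/
noncomputable def increment (M : Market X T d e) (t : Fin T) (ω : X) : EuclideanSpace ℝ (Fin d) :=
  M.S t.succ ω - M.S t.castSucc ω

/-- A conditional splitting of `Γ` over the `t`-th period. The sets `B j = E j ∩ Γ`,
`j = 0, …, β`, partition `Γ`; the vector `H i` belongs to the set `B i.succ`, so
`H 0, …, H (β - 1)` are the vectors usually written `H¹, …, H^β`. -/
structure CondSplitting (M : Market X T d e) (t : Fin T) (Γ : Set X) where
  /-- level of the projective hierarchy -/
  n : ℕ
  /-- number of arbitrage sets -/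
  β : ℕ
  β_le : β ≤ d
  /-- the arbitrage strategies -/
  H : Fin β → X → EuclideanSpace ℝ (Fin d)
  /-- the sets whose traces on `Γ` form the splitting -/
  E : Fin (β + 1) → Set X
  measurable_H : ∀ i, Measurable[M.projAlgebra n t.castSucc] (H i)
  measurable_E : ∀ j, MeasurableSet[M.projAlgebra n t.succ] (E j)
  disjoint : ∀ i j, i ≠ j → Disjoint (E i ∩ Γ) (E j ∩ Γ)
  cover : (⋃ j, E j ∩ Γ) = Γ
  nonempty : ∀ i : Fin β, (E i.succ ∩ Γ).Nonempty
  pos : ∀ i : Fin β, ∀ ω ∈ E i.succ ∩ Γ, 0 < inner ℝ (H i ω) (M.increment t ω)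
  nonneg : ∀ i j : Fin β, i ≤ j → ∀ ω ∈ E j.succ ∩ Γ, 0 ≤ inner ℝ (H i ω) (M.increment t ω)
  nonneg_zero : ∀ i : Fin β, ∀ ω ∈ E 0 ∩ Γ, 0 ≤ inner ℝ (H i ω) (M.increment t ω)
  no_arbitrage : ∀ K : X → EuclideanSpace ℝ (Fin d), Measurable[M.projAlgebra n t.castSucc] K →
    (∀ ω ∈ E 0 ∩ Γ, 0 ≤ inner ℝ (K ω) (M.increment t ω)) →
    ∀ ω ∈ E 0 ∩ Γ, inner ℝ (K ω) (M.increment t ω) = 0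

/-- `A 0, …, A T` are the sets `Ω_0, …, Ω_T` of a backward conditional-splitting scheme started
from `Ω_T = Ω`: at each step the sets `B¹, …, B^β` of a conditional splitting of `Ω_t` are
removed from `Ω_t`. -/
def IsBackwardScheme (M : Market X T d e) (Ω : Set X) (A : Fin (T + 1) → Set X) : Prop :=
  A (Fin.last T) = Ω ∧ ∀ t : Fin T, ∃ C : M.CondSplitting t (A t.succ),
    A t.castSucc = A t.succ \ ⋃ i : Fin C.β, C.E i.succ ∩ A t.succ

end Market

/-!
Let `Γ` be a set of scenarios and fix a period `t`. Call a scenario of `Γ` balanced if it is charged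
by a finite positive weighting of scenarios of `Γ` with the same past, under which the price
increment has mean zero. The argument rests on three facts about the set `Market.balanced t Γ`.

*Every conditional splitting of `Γ` leaves exactly the balanced scenarios*
(`Market.CondSplitting.diff_eq_balanced`). A balanced weighting does not charge the arbitrage
sets, since the first of them that it charged would have positive mean gain. Conversely, a strategy
which is constant on one fibre of the past and vanishes elsewhere is measurable, so the remaining
set is arbitrage-free in each fibre; and in an arbitrage-free set of vectors each element occurs in
a vanishing positive combination (`NoArbitrage.exists_weights`, from the M. Riesz extension
theorem). Therefore all backward schemes from `Ω` coincide. As balanced scenarios are obtained by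
projecting along finite sequences of scenarios and weights, each class `Σ¹_n` is preserved
(`Market.balanced_mem_sigmaClass`).

*Splittings exist* (`Market.nonempty_condSplitting`). In each fibre of the past one plays a
canonical vector, the sum of the metric projections of plus and minus the basis vectors to the cone of
all `h` with non-negative inner product with the increments. It is an arbitrage unless there is
none (`noArbitrage_of_inner_arbVector`), and passing to the scenarios where it gains nothing lowers
the dimension of the span of the increments, so `d` rounds suffice. No selection theorem for
projective sets is used: the graph of the canonical vector is defined by quantifiers over Polish
spaces, thus it is projective, and a function with a projective graph is measurable at some level
of the hierarchy.

*Balanced scenarios are those charged by martingale measures.* A finitely supported martingale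
measure restricted to a fibre of the past is a balanced weighting, and balanced weightings of
successive periods can be glued, which gives `Ω* = Ω_0` (`Market.star_eq_of_balanced`). For an
arbitrary martingale measure concentrated on a Borel set `R`, the scenarios whose increment lies
in the support of its conditional law form a Borel set of full measure consisting of balanced
scenarios (`Market.exists_measurableSet_subset_balanced`). Going backward from a Borel set of full
measure inside `Ω`, one finds a non-empty subset of `Ω_0`.
-/

universe v

open scoped NNReal

/-! ### The projective hierarchy -/

section Hierarchy

theorem MeasureTheory.AnalyticSet.preimage_of_measurable {X : Type*} {Y : Type*}
    [TopologicalSpace X] [PolishSpace X] [MeasurableSpace X] [BorelSpace X]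
    [TopologicalSpace Y] [PolishSpace Y] [MeasurableSpace Y] [BorelSpace Y]
    {A : Set Y} (hA : AnalyticSet A) {f : X → Y} (hf : Measurable f) :
    AnalyticSet (f ⁻¹' A) := by
  rw [AnalyticSet] at hA
  rcases hA with rfl | ⟨g, hg, rfl⟩
  · exact analyticSet_empty
  · have hm : MeasurableSet {p : X × (ℕ → ℕ) | f p.1 = g p.2} :=
      measurableSet_eq_fun (hf.comp measurable_fst) (hg.measurable.comp measurable_snd)
    convert hm.analyticSet_image measurable_fst using 1
    ext x
    simp [eq_comm]

namespace SigmaClass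

theorem preimage : ∀ (n : ℕ) {X : Type u} {Y : Type v}
    [TopologicalSpace X] [PolishSpace X] [MeasurableSpace X] [BorelSpace X]
    [TopologicalSpace Y] [PolishSpace Y] [MeasurableSpace Y] [BorelSpace Y]
    {A : Set Y} (_ : A ∈ SigmaClass n Y) {f : X → Y} (_ : Measurable f),
    f ⁻¹' A ∈ SigmaClass n X
  | 0, _, _, _, _, _, _, _, _, _, _, _, hA, _, hf =>
    AnalyticSet.preimage_of_measurable hA hf
  | n + 1, X, Y, _, _, _, _, _, _, _, _, A, hA, f, hf => by
    obtain ⟨B, hB, rfl⟩ := hA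
    refine ⟨Prod.map f id ⁻¹' B, ?_, ?_⟩
    · exact preimage n hB (hf.prodMap measurable_id)
    · ext x
      simp

theorem of_measurableSet : ∀ (n : ℕ) {X : Type u}
    [TopologicalSpace X] [PolishSpace X] [MeasurableSpace X] [BorelSpace X]
    {A : Set X} (_ : MeasurableSet A), A ∈ SigmaClass n X
  | 0, _, _, _, _, _, _, hA => hA.analyticSet
  | n + 1, X, _, _, _, _, A, hA => by
    refine ⟨Prod.fst ⁻¹' A, of_measurableSet n (measurable_fst hA).compl, ?_⟩
    ext x
    simp

/-- Unions and intersections are treated together: in the step from `Σ¹_n` to `Σ¹_{n+1}` the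
union of projections is the projection of a set whose complement is a union of pieces cut out by
Borel sets, and the intersection of projections is the projection of an intersection, whose
complement is a union. -/
theorem iUnion_and_iInter : ∀ (n : ℕ) {X : Type u}
    [TopologicalSpace X] [PolishSpace X] [MeasurableSpace X] [BorelSpace X]
    {A : ℕ → Set X} (_ : ∀ k, A k ∈ SigmaClass n X),
    (⋃ k, A k) ∈ SigmaClass n X ∧ (⋂ k, A k) ∈ SigmaClass n X
  | 0, _, _, _, _, _, _, hA => ⟨AnalyticSet.iUnion hA, AnalyticSet.iInter hA⟩
  | n + 1, X, _, _, _, _, A, hA => by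
    choose B hB hAB using hA
    constructor
    · -- The first entry of the witness selects the member of the family.
      have hg : Measurable fun p : X × (ℕ → ℕ) => (p.1, fun i => p.2 (i + 1)) := by fun_prop
      refine ⟨{p | (p.1, fun i => p.2 (i + 1)) ∈ B (p.2 0)}, ?_, ?_⟩
      · have h1 : {p : X × (ℕ → ℕ) | (p.1, fun i => p.2 (i + 1)) ∈ B (p.2 0)}ᶜ =
            ⋃ k, ({p : X × (ℕ → ℕ) | p.2 0 = k} ∩
              (fun p : X × (ℕ → ℕ) => (p.1, fun i => p.2 (i + 1))) ⁻¹' (B k)ᶜ) := by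
          ext p
          simp
        rw [h1]
        refine (iUnion_and_iInter n fun k => ?_).1
        have hk : MeasurableSet {p : X × (ℕ → ℕ) | p.2 0 = k} :=
          measurableSet_eq_fun (by fun_prop) measurable_const
        have := (iUnion_and_iInter n (A := fun j => if j = 0 then {p : X × (ℕ → ℕ) | p.2 0 = k}
          else (fun p : X × (ℕ → ℕ) => (p.1, fun i => p.2 (i + 1))) ⁻¹' (B k)ᶜ) fun j => by
            split_ifs
            · exact of_measurableSet n hk
            · exact preimage n (hB k) hg).2
        convert this using 1
        ext p
        simp only [Set.mem_inter_iff, Set.mem_iInter]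
        refine ⟨fun h j => by split_ifs; exacts [h.1, h.2], fun h => ⟨by simpa using h 0,
          by simpa using h 1⟩⟩
      · ext x
        simp only [hAB, Set.mem_iUnion, Set.mem_image, Prod.exists, exists_and_right,
          exists_eq_right, Set.mem_ofPred_eq]
        constructor
        · rintro ⟨k, y, hy⟩
          exact ⟨fun i => Nat.casesOn i k y, hy⟩
        · rintro ⟨y, hy⟩
          exact ⟨_, _, hy⟩
    · -- The witness codes one witness for each member of the family.
      have hg (k : ℕ) : Measurable fun p : X × (ℕ → ℕ) => (p.1, fun i => p.2 (Nat.pair k i)) := by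
        fun_prop
      refine ⟨⋂ k, (fun p : X × (ℕ → ℕ) => (p.1, fun i => p.2 (Nat.pair k i))) ⁻¹' B k, ?_, ?_⟩
      · rw [Set.compl_iInter]
        exact (iUnion_and_iInter n fun k => preimage n (hB k) (hg k)).1
      · ext x
        simp only [hAB, Set.mem_iInter, Set.mem_image, Prod.exists, exists_and_right,
          exists_eq_right, Set.mem_preimage]
        constructor
        · intro h
          choose y hy using h
          exact ⟨fun j => y j.unpair.1 j.unpair.2, fun k => by simpa using hy k⟩
        · rintro ⟨y, hy⟩ k
          exact ⟨_, hy k⟩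

variable {n : ℕ} {X : Type u} [TopologicalSpace X] [PolishSpace X]

theorem iUnion {A : ℕ → Set X} (hA : ∀ k, A k ∈ SigmaClass n X) :
    (⋃ k, A k) ∈ SigmaClass n X := by
  borelize X
  exact (iUnion_and_iInter n hA).1

theorem iInter {A : ℕ → Set X} (hA : ∀ k, A k ∈ SigmaClass n X) :
    (⋂ k, A k) ∈ SigmaClass n X := by
  borelize X
  exact (iUnion_and_iInter n hA).2

theorem inter {A B : Set X} (hA : A ∈ SigmaClass n X) (hB : B ∈ SigmaClass n X) :
    A ∩ B ∈ SigmaClass n X := by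
  have := iInter (A := fun k => if k = 0 then A else B) fun k => by
    split_ifs <;> assumption
  convert this using 1
  ext p
  simp only [Set.mem_inter_iff, Set.mem_iInter]
  exact ⟨fun h j => by split_ifs; exacts [h.1, h.2],
    fun h => ⟨by simpa using h 0, by simpa using h 1⟩⟩

theorem iInter_fin {m : ℕ} {A : Fin m → Set X} (hA : ∀ k, A k ∈ SigmaClass n X) :
    (⋂ k, A k) ∈ SigmaClass n X := by
  borelize X
  have := iInter (A := fun k => if h : k < m then A ⟨k, h⟩ else Set.univ) fun k => by
    split_ifs
    · exact hA _
    · exact of_measurableSet n MeasurableSet.univ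
  convert this using 1
  ext p
  simp only [Set.mem_iInter]
  exact ⟨fun h j => by split_ifs; exacts [h _, trivial], fun h k => by simpa using h k⟩

theorem succ_of_compl {A : Set X} (hA : Aᶜ ∈ SigmaClass n X) : A ∈ SigmaClass (n + 1) X := by
  borelize X
  refine ⟨Prod.fst ⁻¹' A, preimage n hA measurable_fst, ?_⟩
  ext x
  simp

/-- An analytic set is even the projection of a closed set: the graph of a continuous function on
`ℕ^ℕ` with this range. -/
theorem succ : ∀ {n : ℕ} {X : Type u} [TopologicalSpace X] [PolishSpace X] {A : Set X}
    (_ : A ∈ SigmaClass n X), A ∈ SigmaClass (n + 1) X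
  | 0, X, _, _, A, hA => by
    borelize X
    have hA' : AnalyticSet A := hA
    rw [AnalyticSet] at hA'
    rcases hA' with rfl | ⟨f, hf, rfl⟩
    · exact of_measurableSet 1 MeasurableSet.empty
    · have hm : MeasurableSet {p : X × (ℕ → ℕ) | f p.2 = p.1} :=
        measurableSet_eq_fun (hf.measurable.comp measurable_snd) measurable_fst
      refine ⟨{p | f p.2 = p.1}, hm.compl.analyticSet, ?_⟩
      ext x
      simp
  | n + 1, X, _, _, A, hA => by
    obtain ⟨B, hB, rfl⟩ := hA
    exact ⟨B, succ hB, rfl⟩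

theorem image_fst_baire : ∀ {n : ℕ} {A : Set (X × (ℕ → ℕ))}
    (_ : A ∈ SigmaClass n (X × (ℕ → ℕ))), Prod.fst '' A ∈ SigmaClass n X
  | 0, A, hA => AnalyticSet.image_of_continuous hA continuous_fst
  | n + 1, A, hA => by
    borelize X
    obtain ⟨B, hB, rfl⟩ := hA
    obtain ⟨e, he, hes⟩ := PolishSpace.exists_nat_nat_continuous_surjective ((ℕ → ℕ) × (ℕ → ℕ))
    have he := he.measurable
    refine ⟨(fun p : X × (ℕ → ℕ) => ((p.1, (e p.2).1), (e p.2).2)) ⁻¹' B,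
      preimage n hB (by fun_prop), ?_⟩
    ext x
    simp only [Set.mem_image, Prod.exists, exists_and_right, exists_eq_right, Set.mem_preimage]
    constructor
    · rintro ⟨y, z, h⟩
      obtain ⟨t, ht⟩ := hes (y, z)
      exact ⟨t, by simpa [ht] using h⟩
    · rintro ⟨t, ht⟩
      exact ⟨_, _, ht⟩

theorem image_fst {Z : Type v} [TopologicalSpace Z] [PolishSpace Z] {A : Set (X × Z)}
    (hA : A ∈ SigmaClass n (X × Z)) : Prod.fst '' A ∈ SigmaClass n X := by
  borelize X Z
  rcases isEmpty_or_nonempty Z with hZ | hZ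
  · have : Prod.fst '' A = (∅ : Set X) := by
      ext x
      simp
    rw [this]
    exact of_measurableSet n MeasurableSet.empty
  · obtain ⟨e, he, hes⟩ := PolishSpace.exists_nat_nat_continuous_surjective Z
    have : Prod.fst '' A = Prod.fst '' (Prod.map id e ⁻¹' A : Set (X × (ℕ → ℕ))) := by
      ext x
      simp [hes.exists]
    rw [this]
    exact image_fst_baire (preimage n hA (measurable_id.prodMap he.measurable))

end SigmaClass

/-- The ambiguous class `Δ¹_{n+1}` of sets which together with their complements are in
`Σ¹_{n+1}`, as a sigma-algebra (index shift as in `SigmaClass`). -/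
abbrev deltaAlgebra (n : ℕ) (X : Type u) [TopologicalSpace X] [PolishSpace X] :
    MeasurableSpace X where
  MeasurableSet' A := A ∈ SigmaClass n X ∧ Aᶜ ∈ SigmaClass n X
  measurableSet_empty := by
    borelize X
    exact ⟨SigmaClass.of_measurableSet n .empty,
      SigmaClass.of_measurableSet n MeasurableSet.empty.compl⟩
  measurableSet_compl A hA := ⟨hA.2, by simpa using hA.1⟩
  measurableSet_iUnion A hA := ⟨SigmaClass.iUnion fun k => (hA k).1, by
    rw [Set.compl_iUnion]
    exact SigmaClass.iInter fun k => (hA k).2⟩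

section Delta

variable {n : ℕ} {X : Type u} [TopologicalSpace X] [PolishSpace X]
  {Y : Type v} [TopologicalSpace Y] [PolishSpace Y]

theorem borel_le_deltaAlgebra [hm : MeasurableSpace X] [BorelSpace X] : hm ≤ deltaAlgebra n X :=
  fun _ hA => ⟨SigmaClass.of_measurableSet n hA, SigmaClass.of_measurableSet n hA.compl⟩

theorem monotone_deltaAlgebra : Monotone fun n => deltaAlgebra n X :=
  monotone_nat_of_le_succ fun _ _ hA => ⟨SigmaClass.succ hA.1, SigmaClass.succ hA.2⟩

theorem SigmaClass.measurableSet_succ {A : Set X} (hA : A ∈ SigmaClass n X) :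
    MeasurableSet[deltaAlgebra (n + 1) X] A :=
  ⟨succ hA, succ_of_compl (by simpa using hA)⟩

theorem Measurable.deltaAlgebra [MeasurableSpace X] [BorelSpace X] [MeasurableSpace Y]
    [BorelSpace Y] {f : X → Y} (hf : Measurable f) :
    Measurable[_root_.deltaAlgebra n X, _root_.deltaAlgebra n Y] f :=
  fun _ hA => ⟨SigmaClass.preimage n hA.1 hf, SigmaClass.preimage n hA.2 hf⟩

theorem isProjective_iff_measurableSet {A : Set X} :
    IsProjective A ↔ ∃ n, MeasurableSet[deltaAlgebra n X] A :=
  ⟨fun ⟨n, h⟩ => ⟨n + 1, SigmaClass.measurableSet_succ h⟩, fun ⟨n, h⟩ => ⟨n, h.1⟩⟩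

namespace IsProjective

theorem compl {A : Set X} (hA : IsProjective A) : IsProjective Aᶜ := by
  rw [isProjective_iff_measurableSet] at *
  exact hA.imp fun n h => h.compl

theorem inter {A B : Set X} (hA : IsProjective A) (hB : IsProjective B) :
    IsProjective (A ∩ B) := by
  rw [isProjective_iff_measurableSet] at *
  obtain ⟨n, hA⟩ := hA
  obtain ⟨m, hB⟩ := hB
  exact ⟨max n m, (monotone_deltaAlgebra (le_max_left n m) _ hA).inter
    (monotone_deltaAlgebra (le_max_right n m) _ hB)⟩

theorem of_measurableSet [MeasurableSpace X] [BorelSpace X] {A : Set X} (hA : MeasurableSet A) :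
    IsProjective A :=
  ⟨0, SigmaClass.of_measurableSet 0 hA⟩

theorem preimage [MeasurableSpace X] [BorelSpace X] [MeasurableSpace Y] [BorelSpace Y]
    {A : Set Y} (hA : IsProjective A) {f : X → Y} (hf : Measurable f) : IsProjective (f ⁻¹' A) :=
  hA.imp fun n h => SigmaClass.preimage n h hf

theorem exists_prod {A : Set (X × Y)} (hA : IsProjective A) :
    IsProjective {x | ∃ y, (x, y) ∈ A} := by
  obtain ⟨n, h⟩ := hA
  refine ⟨n, ?_⟩
  convert SigmaClass.image_fst h using 1
  ext x
  simp

theorem forall_prod {A : Set (X × Y)} (hA : IsProjective A) :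
    IsProjective {x | ∀ y, (x, y) ∈ A} := by
  convert hA.compl.exists_prod.compl using 1
  ext x
  simp

/-- A function with projective graph is measurable for some level of the hierarchy. -/
theorem exists_measurable_of_graph [MeasurableSpace Y] [BorelSpace Y] {f : X → Y}
    (hf : IsProjective {p : X × Y | p.2 = f p.1}) :
    ∃ n, Measurable[deltaAlgebra n X] f := by
  borelize X
  obtain ⟨n, hn⟩ := hf
  have key (s : Set Y) (hs : MeasurableSet s) : f ⁻¹' s ∈ SigmaClass n X := by
    have := SigmaClass.image_fst
      (SigmaClass.inter hn (SigmaClass.of_measurableSet n (measurable_snd hs)))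
    convert this using 1
    ext x
    simp
  exact ⟨n, fun s hs => ⟨key s hs, key _ hs.compl⟩⟩

end IsProjective

end Delta

end Hierarchy

/-! ### One-period arbitrage in Euclidean space -/

section OnePeriod

variable {E : Type*} [NormedAddCommGroup E] [InnerProductSpace ℝ E]

/-- A set `K` of price increments is arbitrage-free if no vector has non-negative inner product
with all of `K` and positive inner product with some element of `K`. -/
def NoArbitrage (K : Set E) : Prop :=
  ∀ h : E, (∀ k ∈ K, 0 ≤ inner ℝ h k) → ∀ k ∈ K, inner ℝ h k = 0

variable [FiniteDimensional ℝ E]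

/-- The convex cone generated by an arbitrage-free set is a linear subspace. Otherwise, with `s` the
sum of a basis of the span chosen in the set, the functional `c s ↦ c` is non-negative on the part
of the cone on the line through `s`, and its extension given by the M. Riesz extension theorem is
an arbitrage. -/
theorem NoArbitrage.neg_mem_hull {K : Set E} (hK : NoArbitrage K) {k : E} (hk : k ∈ K) :
    -k ∈ PointedCone.hull ℝ K := by
  set W := Submodule.span ℝ K with hW
  obtain ⟨f, hfK, hfW, -⟩ := Submodule.exists_fun_fin_finrank_span_eq ℝ K
  have hKW : K ⊆ W := Submodule.subset_span
  set s : E := ∑ i, f i with hs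
  have hsK : s ∈ W := Submodule.sum_mem _ fun i _ => hKW (hfK i)
  have dense (y : E) (hy : y ∈ W) : ∃ C : ℝ, 0 ≤ C ∧ C • s + y ∈ PointedCone.hull ℝ K := by
    rw [hW, ← hfW, Submodule.mem_span_range_iff_exists_fun] at hy
    obtain ⟨c, rfl⟩ := hy
    refine ⟨∑ i, |c i|, Finset.sum_nonneg fun i _ => abs_nonneg _, ?_⟩
    rw [hs, Finset.smul_sum, ← Finset.sum_add_distrib]
    refine Submodule.sum_mem _ fun i _ => ?_
    rw [← add_smul]
    refine PointedCone.smul_mem _ ?_ (PointedCone.subset_hull (hfK i))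
    have := Finset.single_le_sum (f := fun i => |c i|) (fun i _ => abs_nonneg _) (Finset.mem_univ i)
    linarith [neg_abs_le (c i)]
  by_cases hneg : -s ∈ PointedCone.hull ℝ K
  · obtain ⟨C, hC, h⟩ := dense (-k) (neg_mem (hKW hk))
    have := add_mem h (PointedCone.smul_mem _ hC hneg)
    simpa using this
  · exfalso
    have hs0 : (⟨s, hsK⟩ : W) ≠ 0 := by
      intro h0
      apply hneg
      rw [show s = 0 from congrArg Subtype.val h0, neg_zero]
      exact zero_mem _
    obtain ⟨g, hg, hgpos⟩ := riesz_extension ((PointedCone.hull ℝ K).comap W.subtype)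
      (LinearPMap.mkSpanSingleton (⟨s, hsK⟩ : W) (1 : ℝ) hs0) (by
        rintro ⟨x, hx⟩ hxs
        obtain ⟨c, rfl⟩ := Submodule.mem_span_singleton.1 hx
        rw [LinearPMap.mkSpanSingleton'_apply]
        simp only [smul_eq_mul, mul_one, RingHom.id_apply]
        by_contra! hc
        apply hneg
        have h1 : c • s ∈ PointedCone.hull ℝ K := hxs
        have h2 := PointedCone.smul_mem _ (r := -c⁻¹) (by simpa using hc.le) h1
        rwa [smul_smul, neg_mul, inv_mul_cancel₀ hc.ne, neg_one_smul] at h2) (by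
        rintro ⟨y, hy⟩
        obtain ⟨C, -, hC⟩ := dense y hy
        exact ⟨⟨C • (⟨s, hsK⟩ : W),
          Submodule.smul_mem _ _ (Submodule.mem_span_singleton_self _)⟩, hC⟩)
    obtain ⟨g', hg'⟩ := g.exists_extend
    have hext (x : E) (hx : x ∈ W) : g' x = g ⟨x, hx⟩ := by rw [← hg']; rfl
    set h : E := (InnerProductSpace.toDual ℝ E).symm (LinearMap.toContinuousLinearMap g')
    have hh (x : E) : inner ℝ h x = g' x := by simp [h]
    have hzero := hK h fun x hx => by
      rw [hh, hext x (hKW hx)]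
      exact hgpos _ (PointedCone.subset_hull hx)
    have h0 : g' s = 0 := by
      rw [hs, map_sum]
      exact Finset.sum_eq_zero fun i _ => by rw [← hh]; exact hzero _ (hfK i)
    have h1 : g' s = 1 := by
      rw [hext s hsK]
      have := hg ⟨⟨s, hsK⟩, Submodule.mem_span_singleton_self _⟩
      rw [this]
      exact LinearPMap.mkSpanSingleton'_apply_self _ _ _ _
    linarith

/-- Every element of an arbitrage-free family occurs in a vanishing positive combination. -/
theorem NoArbitrage.exists_weights {ι : Type*} {f : ι → E} {s : Set ι}
    (hs : NoArbitrage (f '' s)) {i : ι} (hi : i ∈ s) :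
    ∃ w : ι →₀ ℝ≥0, w i ≠ 0 ∧ (∀ j ∈ w.support, j ∈ s) ∧ (w.sum fun j a => a • f j) = 0 := by
  classical
  have h := hs.neg_mem_hull (Set.mem_image_of_mem f hi)
  have h' : -f i ∈ Submodule.span ℝ≥0 (f '' s) := h
  rw [Finsupp.mem_span_image_iff_linearCombination] at h'
  obtain ⟨w, hw, hwi⟩ := h'
  refine ⟨w + Finsupp.single i 1, by simp, fun j hj => ?_, ?_⟩
  · rcases Finset.mem_union.1 (Finsupp.support_add hj) with h | h
    · exact hw h
    · rw [Finset.mem_singleton.1 (Finsupp.support_single_subset h)]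
      exact hi
  · rw [Finsupp.sum_add_index' (by simp) (by intros; rw [add_smul])]
    rw [Finsupp.linearCombination_apply] at hwi
    rw [hwi]
    simp

theorem exists_polarProj (K : Set E) (q : E) : ∃ v ∈ ProperCone.innerDual K,
    ‖q - v‖ = ⨅ w : (ProperCone.innerDual K : Set E), ‖q - w‖ :=
  exists_norm_eq_iInf_of_complete_convex (ProperCone.innerDual K).nonempty
    (ProperCone.innerDual K).isClosed.isComplete (ProperCone.innerDual K).toPointedCone.convex q

/-- The metric projection of `q` to the cone of vectors having non-negative inner product with all
elements of `K`. -/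
noncomputable def polarProj (K : Set E) (q : E) : E := (exists_polarProj K q).choose

theorem polarProj_mem (K : Set E) (q : E) : polarProj K q ∈ ProperCone.innerDual K :=
  (exists_polarProj K q).choose_spec.1

theorem inner_sub_polarProj_le (K : Set E) (q : E) {w : E} (hw : w ∈ ProperCone.innerDual K) :
    inner ℝ (q - polarProj K q) (w - polarProj K q) ≤ 0 :=
  (norm_eq_iInf_iff_real_inner_le_zero (ProperCone.innerDual K).toPointedCone.convex
    (polarProj_mem K q)).1 (exists_polarProj K q).choose_spec.2 w hw

theorem eq_polarProj_iff {K : Set E} {q p : E} :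
    p = polarProj K q ↔ p ∈ ProperCone.innerDual K ∧
      ∀ w, w ∈ ProperCone.innerDual K → inner ℝ (q - p) (w - p) ≤ 0 := by
  refine ⟨fun h => h ▸ ⟨polarProj_mem K q, fun w hw => inner_sub_polarProj_le K q hw⟩, ?_⟩
  rintro ⟨hp, h⟩
  have h1 := h _ (polarProj_mem K q)
  have h2 := inner_sub_polarProj_le K q hp
  have h3 : inner ℝ (p - polarProj K q) (p - polarProj K q) ≤ 0 := by
    have e : inner ℝ (p - polarProj K q) (p - polarProj K q) =
        inner ℝ (q - p) (polarProj K q - p) + inner ℝ (q - polarProj K q) (p - polarProj K q) := by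
      simp only [inner_sub_left, inner_sub_right, real_inner_comm]
      ring
    linarith
  exact sub_eq_zero.1 (real_inner_self_nonpos.1 h3)

/-- A canonical arbitrage vector for the set of increments `K`: the sum of the projections of
plus and minus the vectors of an orthonormal basis to the polar cone. -/
noncomputable def arbVector (K : Set E) : E :=
  ∑ i, (polarProj K (stdOrthonormalBasis ℝ E i) + polarProj K (-stdOrthonormalBasis ℝ E i))

theorem inner_arbVector_nonneg {K : Set E} {k : E} (hk : k ∈ K) : 0 ≤ inner ℝ (arbVector K) k := by
  have (q : E) : 0 ≤ inner ℝ (polarProj K q) k := by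
    rw [real_inner_comm]
    exact ProperCone.mem_innerDual.1 (polarProj_mem K q) hk
  rw [arbVector, sum_inner]
  exact Finset.sum_nonneg fun i _ => by rw [inner_add_left]; exact add_nonneg (this _) (this _)

/-- If the canonical vector is orthogonal to `K`, then the projections of all basis vectors lie in
the orthogonal complement of `K`. So they are linear in the basis vector, and the polar cone
is this complement. -/
theorem noArbitrage_of_inner_arbVector {K : Set E}
    (h : ∀ k ∈ K, inner ℝ (arbVector K) k = 0) : NoArbitrage K := by
  have hmem {g : E} : g ∈ ProperCone.innerDual K ↔ ∀ k ∈ K, 0 ≤ inner ℝ g k := by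
    rw [ProperCone.mem_innerDual]
    exact forall₂_congr fun k _ => by rw [real_inner_comm]
  have hpos (q k : E) (hk : k ∈ K) : 0 ≤ inner ℝ (polarProj K q) k :=
    hmem.1 (polarProj_mem K q) k hk
  set e := stdOrthonormalBasis ℝ E with he
  have hz (i) (k : E) (hk : k ∈ K) :
      inner ℝ (polarProj K (e i)) k = 0 ∧ inner ℝ (polarProj K (-e i)) k = 0 := by
    have h0 := h k hk
    rw [arbVector, sum_inner, Finset.sum_eq_zero_iff_of_nonneg fun i _ => by
      rw [inner_add_left]; exact add_nonneg (hpos _ k hk) (hpos _ k hk)] at h0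
    have h1 := h0 i (Finset.mem_univ i)
    rw [inner_add_left] at h1
    constructor <;> linarith [hpos (e i) k hk, hpos (-e i) k hk]
  have hle (q : E) (hq : ∀ k ∈ K, inner ℝ (polarProj K q) k = 0) (g : E)
      (hg : ∀ k ∈ K, 0 ≤ inner ℝ g k) : inner ℝ (q - polarProj K q) g ≤ 0 := by
    have := inner_sub_polarProj_le K q (w := g + polarProj K q)
      (hmem.2 fun k hk => by rw [inner_add_left, hq k hk, add_zero]; exact hg k hk)
    rwa [add_sub_cancel_right] at this
  have hperp (q : E) (hq : ∀ k ∈ K, inner ℝ (polarProj K q) k = 0) (g : E)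
      (hg : ∀ k ∈ K, inner ℝ g k = 0) : inner ℝ (q - polarProj K q) g = 0 := by
    have h1 := hle q hq g fun k hk => (hg k hk).ge
    have h2 := hle q hq (-g) fun k hk => by rw [inner_neg_left, hg k hk, neg_zero]
    rw [inner_neg_right] at h2
    linarith
  have hodd (i) : polarProj K (e i) + polarProj K (-e i) = 0 := by
    rw [← inner_self_eq_zero (𝕜 := ℝ)]
    have hp : ∀ k ∈ K, inner ℝ (polarProj K (e i) + polarProj K (-e i)) k = 0 := fun k hk => by
      rw [inner_add_left, (hz i k hk).1, (hz i k hk).2, add_zero]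
    have h1 := hperp (e i) (fun k hk => (hz i k hk).1) _ hp
    have h2 := hperp (-e i) (fun k hk => (hz i k hk).2) _ hp
    rw [inner_sub_left] at h1 h2
    rw [inner_neg_left] at h2
    rw [inner_add_left]
    linarith
  intro g hg k hk
  have hv (i) : inner ℝ (e i - polarProj K (e i)) g = 0 := by
    have h1 := hle (e i) (fun k hk => (hz i k hk).1) g hg
    have h2 := hle (-e i) (fun k hk => (hz i k hk).2) g hg
    have h3 : -e i - polarProj K (-e i) = -(e i - polarProj K (e i)) := by
      rw [eq_neg_of_add_eq_zero_right (hodd i)]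
      abel
    rw [h3, inner_neg_left] at h2
    linarith
  set p : E := ∑ i, inner ℝ (e i) k • polarProj K (e i) with hp
  have hpK : ∀ k ∈ K, inner ℝ p k = 0 := fun x hx => by
    rw [hp, sum_inner]
    exact Finset.sum_eq_zero fun i _ => by rw [inner_smul_left, (hz i x hx).1, mul_zero]
  have hkp : k - p = ∑ i, inner ℝ (e i) k • (e i - polarProj K (e i)) := by
    simp only [smul_sub, Finset.sum_sub_distrib, e.sum_repr' k, hp]
  have hp0 : p = 0 := by
    rw [← inner_self_eq_zero (𝕜 := ℝ)]
    have h1 : inner ℝ (k - p) p = 0 := by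
      rw [hkp, sum_inner]
      exact Finset.sum_eq_zero fun i _ => by
        rw [inner_smul_left, hperp (e i) (fun k hk => (hz i k hk).1) p hpK, mul_zero]
    rw [inner_sub_left, real_inner_comm, hpK k hk] at h1
    linarith
  rw [hp0, sub_zero] at hkp
  rw [hkp, inner_sum]
  exact Finset.sum_eq_zero fun i _ => by rw [inner_smul_right, real_inner_comm _ g, hv i, mul_zero]

/-- Restricting to the hyperplane orthogonal to the canonical vector lowers the dimension unless
the set is arbitrage-free. -/
theorem finrank_span_lt_of_not_noArbitrage {K : Set E} (hK : ¬ NoArbitrage K) :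
    Module.finrank ℝ (Submodule.span ℝ {k ∈ K | inner ℝ (arbVector K) k = 0}) <
      Module.finrank ℝ (Submodule.span ℝ K) := by
  refine Submodule.finrank_lt_finrank_of_lt
    (lt_of_le_of_ne (Submodule.span_mono fun k hk => hk.1) fun heq => hK ?_)
  refine noArbitrage_of_inner_arbVector fun k hk => ?_
  have hle : Submodule.span ℝ {k ∈ K | inner ℝ (arbVector K) k = 0} ≤
      LinearMap.ker (innerₛₗ ℝ (arbVector K)) :=
    Submodule.span_le.2 fun x hx => hx.2
  exact hle (heq ▸ Submodule.subset_span hk)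

end OnePeriod

/-! ### Conditional splittings -/

section Definability

variable {E : Type*} [NormedAddCommGroup E] [InnerProductSpace ℝ E] [FiniteDimensional ℝ E]
  [PolishSpace E] [MeasurableSpace E] [BorelSpace E]
  {P : Type u} [TopologicalSpace P] [PolishSpace P] [MeasurableSpace P] [BorelSpace P]
  {Z : Type v} [TopologicalSpace Z] [PolishSpace Z] [MeasurableSpace Z] [BorelSpace Z]

/-- The graph of the projection is defined from `Γ` by quantifiers over Polish spaces, hence is
projective; no selection theorem is involved. -/
theorem exists_measurable_polarProj {Γ : Set Z} (hΓ : IsProjective Γ) {τ : Z → P}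
    (hτ : Measurable τ) {f : Z → E} (hf : Measurable f) (q : E) :
    ∃ n, Measurable[deltaAlgebra n P] fun x => polarProj (f '' {z ∈ Γ | τ z = x}) q := by
  have hR : IsProjective
      {p : P × E | p.2 ∈ ProperCone.innerDual (f '' {z ∈ Γ | τ z = p.1})} := by
    have h1 : IsProjective {p : (P × E) × Z | τ p.2 = p.1.1 ∧ inner ℝ (f p.2) p.1.2 < 0} := by
      refine .of_measurableSet (MeasurableSet.inter (s₁ := {p : (P × E) × Z | τ p.2 = p.1.1}) ?_ ?_)
      · exact measurableSet_eq_fun (by fun_prop) (by fun_prop)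
      · have h : Measurable fun p : (P × E) × Z => inner ℝ (f p.2) p.1.2 := by fun_prop
        exact h measurableSet_Iio
    convert ((hΓ.preimage (measurable_snd : Measurable fun p : (P × E) × Z => p.2)).inter
      h1).compl.forall_prod using 1
    ext p
    simp only [Set.mem_ofPred_eq, ProperCone.mem_innerDual, Set.forall_mem_image, Set.mem_compl_iff,
      Set.mem_inter_iff, Set.mem_preimage, not_and, not_lt, and_imp]
  have hG : IsProjective {p : (P × E) × E |
      (p.1.1, p.2) ∈ {p : P × E | p.2 ∈ ProperCone.innerDual (f '' {z ∈ Γ | τ z = p.1})} ∧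
        0 < inner ℝ (q - p.1.2) (p.2 - p.1.2)} := by
    refine (hR.preimage (by fun_prop : Measurable fun p : (P × E) × E => (p.1.1, p.2))).inter
      (.of_measurableSet ?_)
    have h : Measurable fun p : (P × E) × E => inner ℝ (q - p.1.2) (p.2 - p.1.2) := by fun_prop
    exact h measurableSet_Ioi
  refine IsProjective.exists_measurable_of_graph ?_
  convert hR.inter hG.compl.forall_prod using 1
  ext p
  simp only [Set.mem_ofPred_eq, eq_polarProj_iff, Set.mem_inter_iff, Set.mem_compl_iff, not_and,
    not_lt]

theorem exists_measurable_arbVector {Γ : Set Z} (hΓ : IsProjective Γ) {τ : Z → P}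
    (hτ : Measurable τ) {f : Z → E} (hf : Measurable f) :
    ∃ n, Measurable[deltaAlgebra n P] fun x => arbVector (f '' {z ∈ Γ | τ z = x}) := by
  choose n hn using exists_measurable_polarProj hΓ hτ hf
  let e := stdOrthonormalBasis ℝ E
  refine ⟨Finset.univ.sup fun i => max (n (e i)) (n (-e i)), ?_⟩
  have hle (i) := Finset.le_sup (f := fun i => max (n (e i)) (n (-e i))) (Finset.mem_univ i)
  unfold arbVector
  refine Finset.measurable_sum _ fun i _ => ?_
  exact ((hn (e i)).mono (monotone_deltaAlgebra ((le_max_left _ _).trans (hle i))) le_rfl).add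
    ((hn (-e i)).mono (monotone_deltaAlgebra ((le_max_right _ _).trans (hle i))) le_rfl)

end Definability

namespace Market

variable {X : Type u} [MeasurableSpace X] {T d e : ℕ} (M : Market X T d e)

theorem measurable_traj (t : Fin (T + 1)) : Measurable (M.traj t) :=
  measurable_pi_lambda _ fun r => M.measurable_pair r.1

theorem measurable_increment (t : Fin T) : Measurable (M.increment t) :=
  (M.measurable_S _).sub (M.measurable_S _)

variable {M} in
theorem traj_eq_of_le {s t : Fin (T + 1)} (hst : s ≤ t) {ω ω' : X} (h : M.traj t ω = M.traj t ω') :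
    M.traj s ω = M.traj s ω' :=
  funext fun r => congrFun h ⟨r.1, r.2.trans hst⟩

variable {M} in
theorem S_eq_of_traj_eq {t : Fin (T + 1)} {ω ω' : X} (h : M.traj t ω = M.traj t ω') :
    M.S t ω = M.S t ω' :=
  congrArg Prod.fst (congrFun h ⟨t, Set.self_mem_Iic⟩)

variable {M} in
theorem increment_eq_of_traj_eq {t : Fin T} {ω ω' : X}
    (h : M.traj t.succ ω = M.traj t.succ ω') : M.increment t ω = M.increment t ω' := by
  unfold increment
  rw [S_eq_of_traj_eq h, S_eq_of_traj_eq (traj_eq_of_le t.castSucc_lt_succ.le h)]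

/-- The scenarios of `Γ` which are charged by some finite positive weighting of scenarios of `Γ`
with a common past, under which the increment over the `t`-th period has mean zero. -/
def balanced (t : Fin T) (Γ : Set X) : Set X :=
  {ω | ∃ w : X →₀ ℝ≥0, w ω ≠ 0 ∧
    (∀ ω' ∈ w.support, ω' ∈ Γ ∧ M.traj t.castSucc ω' = M.traj t.castSucc ω) ∧
    (w.sum fun ω' a => a • M.increment t ω') = 0}

variable {M} in
theorem balanced_mono {t : Fin T} {Γ Γ' : Set X} (h : Γ ⊆ Γ') :
    M.balanced t Γ ⊆ M.balanced t Γ' :=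
  fun _ ⟨w, hw, hs, h0⟩ => ⟨w, hw, fun ω' hω' => ⟨h (hs ω' hω').1, (hs ω' hω').2⟩, h0⟩

variable {M} in
theorem mem_balanced_of_noArbitrage {t : Fin T} {Γ : Set X} {ω : X} (hω : ω ∈ Γ)
    (h : NoArbitrage
      (M.increment t '' {ω' ∈ Γ | M.traj t.castSucc ω' = M.traj t.castSucc ω})) :
    ω ∈ M.balanced t Γ :=
  h.exists_weights ⟨hω, rfl⟩

section Uniqueness

variable {M}

theorem measurable_projAlgebra {n : ℕ} {t : Fin (T + 1)} {Y : Type*} [MeasurableSpace Y]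
    {f : (Set.Iic t → EuclideanSpace ℝ (Fin d) × EuclideanSpace ℝ (Fin e)) → Y}
    (hf : Measurable[deltaAlgebra n _] f) :
    Measurable[M.projAlgebra n t] fun ω => f (M.traj t ω) :=
  fun _ hs => MeasurableSpace.measurableSet_generateFrom ⟨_, (hf hs).1, rfl⟩

/-- Functions measurable for `F^{pr,n}_t` are constant on the fibres of the trajectory map. -/
theorem eq_of_measurable_projAlgebra {n : ℕ} {t : Fin (T + 1)} {Y : Type*} [MeasurableSpace Y]
    [MeasurableSingletonClass Y] {f : X → Y} (hf : Measurable[M.projAlgebra n t] f) {ω ω' : X}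
    (h : M.traj t ω = M.traj t ω') : f ω = f ω' := by
  have hle : M.projAlgebra n t ≤ MeasurableSpace.comap (M.traj t) ⊤ := by
    refine MeasurableSpace.generateFrom_le ?_
    rintro _ ⟨L, -, rfl⟩
    exact ⟨L, trivial, rfl⟩
  obtain ⟨L, -, hL⟩ := hle _ (hf (measurableSet_singleton (f ω)))
  have h1 : ω ∈ M.traj t ⁻¹' L := hL ▸ rfl
  have h2 : ω' ∈ f ⁻¹' {f ω} := hL ▸ (show M.traj t ω' ∈ L from h ▸ h1)
  exact h2.symm

/-- What remains after the arbitrage sets of a conditional splitting are removed does not depend on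
the splitting. A balanced weighting avoids each arbitrage set, as its strategy would gain on
average. Conversely, in each fibre of the past, the remaining set is arbitrage-free since constant
strategies on a single fibre are measurable. -/
theorem CondSplitting.diff_eq_balanced {t : Fin T} {Γ : Set X} (C : M.CondSplitting t Γ) :
    Γ \ ⋃ i : Fin C.β, C.E i.succ ∩ Γ = M.balanced t Γ := by
  ext ω
  constructor
  · rintro ⟨hω, hωE⟩
    have hmem : ∀ {ω'}, ω' ∈ Γ → (∀ i : Fin C.β, ω' ∉ C.E i.succ) → ω' ∈ C.E 0 := by
      intro ω' h h'
      rw [← C.cover, Set.mem_iUnion] at h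
      obtain ⟨j, hj⟩ := h
      cases j using Fin.cases with
      | zero => exact hj.1
      | succ i => exact absurd hj.1 (h' i)
    have hω0 : ω ∈ C.E 0 ∩ Γ := ⟨hmem hω fun i hi => hωE (Set.mem_iUnion.2 ⟨i, hi, hω⟩), hω⟩
    refine balanced_mono (Set.inter_subset_right (s := C.E 0))
      (mem_balanced_of_noArbitrage hω0 ?_)
    rintro h hh _ ⟨ω', ⟨hω', htr⟩, rfl⟩
    set x := M.traj t.castSucc ω
    have hx : MeasurableSet[M.projAlgebra C.n t.castSucc] (M.traj t.castSucc ⁻¹' {x}) :=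
      MeasurableSpace.measurableSet_generateFrom
        ⟨_, SigmaClass.of_measurableSet _ (measurableSet_singleton x), rfl⟩
    have hK : Measurable[M.projAlgebra C.n t.castSucc]
        ((M.traj t.castSucc ⁻¹' {x}).indicator fun _ => h) :=
      measurable_const.indicator hx
    have key := C.no_arbitrage _ hK (fun ω'' hω'' => by
      by_cases h2 : M.traj t.castSucc ω'' = x
      · rw [Set.indicator_of_mem (show ω'' ∈ M.traj t.castSucc ⁻¹' {x} from h2)]
        exact hh _ ⟨ω'', ⟨hω'', h2⟩, rfl⟩
      · rw [Set.indicator_of_notMem (show ω'' ∉ M.traj t.castSucc ⁻¹' {x} from h2)]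
        simp) ω' hω'
    rwa [Set.indicator_of_mem (show ω' ∈ M.traj t.castSucc ⁻¹' {x} from htr)] at key
  · rintro hω
    have hsub : ∀ {ω}, ω ∈ M.balanced t Γ → ω ∈ Γ := fun ⟨w, hw, hs, _⟩ =>
      (hs _ (Finsupp.mem_support_iff.2 hw)).1
    -- By induction on the index, no balanced scenario is in an arbitrage set.
    have key : ∀ (m : ℕ) (i : Fin C.β), i.1 = m → ∀ ω ∈ M.balanced t Γ, ω ∉ C.E i.succ := by
      intro m
      induction m using Nat.strong_induction_on with
      | _ m ih =>
        rintro i rfl ω ⟨w, hw, hs, h0⟩ hωE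
        have hbal : ∀ ω' ∈ w.support, ω' ∈ M.balanced t Γ := fun ω' hω' =>
          ⟨w, Finsupp.mem_support_iff.1 hω', fun ω'' hω'' =>
            ⟨(hs ω'' hω'').1, (hs ω'' hω'').2.trans (hs ω' hω').2.symm⟩, h0⟩
        have hnn : ∀ ω' ∈ w.support, 0 ≤ inner ℝ (C.H i ω') (M.increment t ω') := by
          intro ω' hω'
          have hΓ' := (hs ω' hω').1
          have hc := hΓ'
          rw [← C.cover, Set.mem_iUnion] at hc
          obtain ⟨j, hj⟩ := hc
          cases j using Fin.cases with
          | zero => exact C.nonneg_zero i ω' hj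
          | succ j =>
            rcases le_or_gt i j with hij | hij
            · exact C.nonneg i j hij ω' hj
            · exact absurd hj.1 (ih j.1 hij j rfl ω' (hbal ω' hω'))
        have hωs := Finsupp.mem_support_iff.2 hw
        have hsum : ∑ ω' ∈ w.support, (w ω' : ℝ) * inner ℝ (C.H i ω') (M.increment t ω') = 0 := by
          have h1 : ∀ ω' ∈ w.support, (w ω' : ℝ) * inner ℝ (C.H i ω') (M.increment t ω') =
              inner ℝ (C.H i ω) (w ω' • M.increment t ω') := fun ω' hω' => by
            rw [NNReal.smul_def, inner_smul_right,
              eq_of_measurable_projAlgebra (C.measurable_H i) (hs ω' hω').2]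
          rw [Finset.sum_congr rfl h1, ← inner_sum]
          have h0' : ∑ ω' ∈ w.support, w ω' • M.increment t ω' = 0 := h0
          rw [h0', inner_zero_right]
        have hpos := C.pos i ω ⟨hωE, (hs ω hωs).1⟩
        have := (Finset.sum_eq_zero_iff_of_nonneg fun ω' hω' =>
          mul_nonneg (w ω').2 (hnn ω' hω')).1 hsum ω hωs
        exact (mul_pos (NNReal.coe_pos.2 (pos_iff_ne_zero.2 hw)) hpos).ne' this
    refine ⟨hsub hω, fun h => ?_⟩
    obtain ⟨i, hi⟩ := Set.mem_iUnion.1 h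
    exact key i.1 i rfl ω hω hi.1

end Uniqueness

section Existence

/-- The increments over the `t`-th period in the scenarios of `Γ` with past `x`. -/
def increments (t : Fin T) (Γ : Set X)
    (x : Set.Iic t.castSucc → EuclideanSpace ℝ (Fin d) × EuclideanSpace ℝ (Fin e)) :
    Set (EuclideanSpace ℝ (Fin d)) :=
  M.increment t '' {ω ∈ Γ | M.traj t.castSucc ω = x}

/-- The gain of the strategy that plays the canonical arbitrage vector of `Γ` in each fibre. -/
noncomputable def gain (t : Fin T) (Γ : Set X) (ω : X) : ℝ :=
  inner ℝ (arbVector (M.increments t Γ (M.traj t.castSucc ω))) (M.increment t ω)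

/-- The scenarios of `Γ` in which the canonical strategy gains nothing. -/
def cut (t : Fin T) (Γ : Set X) : Set X := {ω ∈ Γ | M.gain t Γ ω = 0}

variable {M} {t : Fin T} {Γ : Set X}

theorem gain_nonneg {ω : X} (hω : ω ∈ Γ) : 0 ≤ M.gain t Γ ω :=
  inner_arbVector_nonneg ⟨ω, ⟨hω, rfl⟩, rfl⟩

theorem increments_cut (x) : M.increments t (M.cut t Γ) x =
    {k ∈ M.increments t Γ x | inner ℝ (arbVector (M.increments t Γ x)) k = 0} := by
  ext k
  constructor
  · rintro ⟨ω, ⟨⟨hω, h0⟩, rfl⟩, rfl⟩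
    exact ⟨⟨ω, ⟨hω, rfl⟩, rfl⟩, h0⟩
  · rintro ⟨⟨ω, ⟨hω, rfl⟩, rfl⟩, h0⟩
    exact ⟨ω, ⟨⟨hω, h0⟩, rfl⟩, rfl⟩

theorem exists_gain_pos_of_not_noArbitrage {x} (h : ¬ NoArbitrage (M.increments t Γ x)) :
    ∃ ω ∈ Γ, 0 < M.gain t Γ ω := by
  by_contra! hc
  refine h (noArbitrage_of_inner_arbVector ?_)
  rintro _ ⟨ω, ⟨hω, rfl⟩, rfl⟩
  exact le_antisymm (hc ω hω) (gain_nonneg hω)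

/-- After `d` cuts no arbitrage is left, since each cut lowers the dimension of the increments in
those fibres where there is an arbitrage. -/
theorem noArbitrage_increments_cut (t : Fin T) (Γ : Set X) (x) :
    NoArbitrage (M.increments t ((M.cut t)^[d] Γ) x) := by
  have key (i : ℕ) : NoArbitrage (M.increments t ((M.cut t)^[i] Γ) x) ∨
      Module.finrank ℝ (Submodule.span ℝ (M.increments t ((M.cut t)^[i] Γ) x)) + i ≤ d := by
    induction i with
    | zero =>
      right
      exact (Submodule.finrank_le _).trans_eq finrank_euclideanSpace_fin
    | succ i ih =>
      rw [Function.iterate_succ_apply']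
      set Δ := (M.cut t)^[i] Γ
      by_cases hNA : NoArbitrage (M.increments t Δ x)
      · left
        have : M.increments t (M.cut t Δ) x = M.increments t Δ x := by
          rw [increments_cut]
          exact Set.sep_eq_self_iff_mem_true.2
            (hNA _ fun k hk => inner_arbVector_nonneg hk)
        rwa [this]
      · right
        have := finrank_span_lt_of_not_noArbitrage hNA
        rw [← increments_cut] at this
        have := ih.resolve_left hNA
        omega
  rcases key d with h | h
  · exact h
  · have h0 : Submodule.span ℝ (M.increments t ((M.cut t)^[d] Γ) x) = ⊥ :=
      Submodule.finrank_eq_zero.1 (by omega)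
    rw [Submodule.span_eq_bot] at h0
    intro g _ k hk
    rw [h0 k hk, inner_zero_right]

theorem mem_iterate_cut {i : ℕ} {ω : X} : ω ∈ (M.cut t)^[i] Γ ↔
    ω ∈ Γ ∧ ∀ l < i, M.gain t ((M.cut t)^[l] Γ) ω = 0 := by
  induction i with
  | zero => simp
  | succ i ih =>
    rw [Function.iterate_succ_apply', cut, Set.mem_ofPred_eq, ih, and_assoc]
    refine and_congr_right fun _ => ⟨fun h l hl => ?_, fun h => ⟨fun l hl => h l (by omega),
      h i (by omega)⟩⟩
    rcases Nat.lt_succ_iff_lt_or_eq.1 hl with h' | rfl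
    exacts [h.1 l h', h.2]

variable [TopologicalSpace X] [PolishSpace X] [BorelSpace X]

theorem isProjective_cut (hΓ : IsProjective Γ) : IsProjective (M.cut t Γ) := by
  obtain ⟨n, hn⟩ := exists_measurable_arbVector hΓ (M.measurable_traj t.castSucc)
    (M.measurable_increment t)
  have h1 : Measurable[deltaAlgebra n X] (M.gain t Γ) :=
    (hn.comp (M.measurable_traj t.castSucc).deltaAlgebra).inner
      ((M.measurable_increment t).mono borel_le_deltaAlgebra le_rfl)
  exact hΓ.inter (isProjective_iff_measurableSet.2 ⟨n, h1 (measurableSet_singleton 0)⟩)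

theorem isProjective_iterate_cut (hΓ : IsProjective Γ) (i : ℕ) :
    IsProjective ((M.cut t)^[i] Γ) := by
  induction i with
  | zero => exact hΓ
  | succ i ih =>
    rw [Function.iterate_succ_apply']
    exact isProjective_cut ih

/-- The arbitrage sets are the sets removed by successive cuts. Their number is the first number of
cuts after which every fibre is arbitrage-free, so that none of them is empty, and the level of the
splitting bounds the levels of the finitely many strategies. -/
theorem nonempty_condSplitting (t : Fin T) (hΓ : IsProjective Γ) :
    Nonempty (M.CondSplitting t Γ) := by
  classical
  have hex : ∃ i, ∀ x, NoArbitrage (M.increments t ((M.cut t)^[i] Γ) x) :=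
    ⟨d, noArbitrage_increments_cut t Γ⟩
  let β := Nat.find hex
  have hβ : ∀ x, NoArbitrage (M.increments t ((M.cut t)^[β] Γ) x) := Nat.find_spec hex
  choose n hn using fun i => exists_measurable_arbVector (isProjective_iterate_cut hΓ i)
    (M.measurable_traj t.castSucc) (M.measurable_increment t)
  let N := (Finset.range β).sup n
  have hN (i : ℕ) (hi : i < β) : Measurable[deltaAlgebra N _]
      fun x => arbVector (M.increments t ((M.cut t)^[i] Γ) x) :=
    (hn i).mono (monotone_deltaAlgebra (Finset.le_sup (Finset.mem_range.2 hi))) le_rfl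
  have hgain (i : ℕ) (hi : i < β) :
      Measurable[M.projAlgebra N t.succ] (M.gain t ((M.cut t)^[i] Γ)) := by
    have hle : t.castSucc ≤ t.succ := t.castSucc_lt_succ.le
    have hr : Measurable fun (p : Set.Iic t.succ →
        EuclideanSpace ℝ (Fin d) × EuclideanSpace ℝ (Fin e)) (r : Set.Iic t.castSucc) =>
          p ⟨r.1, r.2.trans hle⟩ := by fun_prop
    have hS : Measurable fun p : Set.Iic t.succ →
        EuclideanSpace ℝ (Fin d) × EuclideanSpace ℝ (Fin e) =>
          (p ⟨t.succ, Set.self_mem_Iic⟩).1 - (p ⟨t.castSucc, hle⟩).1 := by fun_prop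
    exact measurable_projAlgebra (((hN i hi).comp hr.deltaAlgebra).inner
      (hS.mono borel_le_deltaAlgebra le_rfl))
  let g (i : Fin β) (ω : X) : ℝ := M.gain t ((M.cut t)^[i] Γ) ω
  have hg (i : Fin β) : Measurable[M.projAlgebra N t.succ] (g i) := hgain i i.2
  let E : Fin (β + 1) → Set X := Fin.cons (⋂ l, {ω | g l ω = 0})
    fun i => {ω | 0 < g i ω} ∩ ⋂ l : Set.Iio i, {ω | g l ω = 0}
  have hE0 (ω) (hω : ω ∈ E 0 ∩ Γ) (l) : g l ω = 0 := Set.mem_iInter.1 hω.1 l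
  have hEpos (i) (ω) (hω : ω ∈ E (Fin.succ i) ∩ Γ) : 0 < g i ω := hω.1.1
  have hElt (i) (ω) (hω : ω ∈ E (Fin.succ i) ∩ Γ) (l) (hl : l < i) : g l ω = 0 :=
    Set.mem_iInter.1 hω.1.2 ⟨l, hl⟩
  have hcut (i : Fin β) (ω) : ω ∈ (M.cut t)^[i] Γ ↔ ω ∈ Γ ∧ ∀ l < i, g l ω = 0 := by
    rw [mem_iterate_cut]
    exact and_congr_right fun _ => ⟨fun h l hl => h l hl, fun h l hl => h ⟨l, hl.trans i.2⟩ hl⟩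
  have hcutβ (ω) : ω ∈ (M.cut t)^[β] Γ ↔ ω ∈ E 0 ∩ Γ := by
    rw [mem_iterate_cut]
    exact ⟨fun h => ⟨Set.mem_iInter.2 fun l => h.2 l l.2, h.1⟩,
      fun h => ⟨h.2, fun l hl => hE0 ω h ⟨l, hl⟩⟩⟩
  have hdisj0 (i) (ω) (h0 : ω ∈ E 0 ∩ Γ) (hi : ω ∈ E (Fin.succ i) ∩ Γ) : False :=
    (hEpos i ω hi).ne' (hE0 ω h0 i)
  have hdisj (i j) (hij : i < j) (ω) (hi : ω ∈ E (Fin.succ i) ∩ Γ) (hj : ω ∈ E (Fin.succ j) ∩ Γ) :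
      False := (hEpos i ω hi).ne' (hElt j ω hj i hij)
  exact ⟨{
    n := N
    β := β
    β_le := Nat.find_min' hex (noArbitrage_increments_cut t Γ)
    H := fun i ω => arbVector (M.increments t ((M.cut t)^[i] Γ) (M.traj t.castSucc ω))
    E := E
    measurable_H := fun i => measurable_projAlgebra (hN i i.2)
    measurable_E := fun j => by
      have h0 (l) : MeasurableSet[M.projAlgebra N t.succ] {ω | g l ω = 0} :=
        hg l (measurableSet_singleton 0)
      cases j using Fin.cases with
      | zero => exact MeasurableSet.iInter h0
      | succ i => exact (hg i measurableSet_Ioi).inter (MeasurableSet.iInter fun l => h0 l)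
    disjoint := fun i j hij => by
      rw [Set.disjoint_left]
      intro ω hi hj
      cases i using Fin.cases with
      | zero =>
        cases j using Fin.cases with
        | zero => exact hij rfl
        | succ j => exact hdisj0 j ω hi hj
      | succ i =>
        cases j using Fin.cases with
        | zero => exact hdisj0 i ω hj hi
        | succ j =>
          rcases lt_trichotomy i j with h | h | h
          · exact hdisj i j h ω hi hj
          · exact hij (congrArg Fin.succ h)
          · exact hdisj j i h ω hj hi
    cover := by
      refine Set.Subset.antisymm (Set.iUnion_subset fun j => Set.inter_subset_right) fun ω hω => ?_
      rw [Set.mem_iUnion]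
      by_cases h : ∀ l, g l ω = 0
      · exact ⟨0, Set.mem_iInter.2 h, hω⟩
      · -- The first non-zero gain determines the arbitrage set.
        push Not at h
        obtain ⟨i, hi, hmin⟩ := WellFounded.has_min (wellFounded_lt (α := Fin β))
          {l | g l ω ≠ 0} h
        have hlt : ∀ l < i, g l ω = 0 := fun l hl => by
          by_contra h'
          exact hmin l h' hl
        refine ⟨i.succ, ⟨?_, Set.mem_iInter.2 fun l => hlt l.1 l.2⟩, hω⟩
        exact lt_of_le_of_ne (gain_nonneg ((hcut i ω).2 ⟨hω, hlt⟩)) (Ne.symm hi)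
    nonempty := fun i => by
      have := Nat.find_min hex i.2
      push Not at this
      obtain ⟨x, hx⟩ := this
      obtain ⟨ω, hω, hpos⟩ := exists_gain_pos_of_not_noArbitrage hx
      rw [hcut] at hω
      exact ⟨ω, ⟨hpos, Set.mem_iInter.2 fun l => hω.2 l.1 l.2⟩, hω.1⟩
    pos := hEpos
    nonneg := fun i j hij ω hω => gain_nonneg
      ((hcut i ω).2 ⟨hω.2, fun l hl => hElt j ω hω l (hl.trans_le hij)⟩)
    nonneg_zero := fun i ω hω => (hE0 ω hω i).ge
    no_arbitrage := fun K hK hpos ω hω => by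
      refine hβ (M.traj t.castSucc ω) (K ω) ?_ _ ⟨ω, ⟨(hcutβ ω).2 hω, rfl⟩, rfl⟩
      rintro _ ⟨ω', ⟨hω', htr⟩, rfl⟩
      rw [← eq_of_measurable_projAlgebra hK htr]
      exact hpos ω' ((hcutβ ω').1 hω') }⟩

end Existence

end Market

/-! ### Projective classes of balanced sets -/

namespace Market

variable {X : Type u} [MeasurableSpace X] {T d e : ℕ} {M : Market X T d e}

section Complexity

variable [TopologicalSpace X] [PolishSpace X] [BorelSpace X]

/-- Passing to the balanced scenarios preserves each projective class: a balanced weighting is a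
finite sequence of scenarios and weights, which are projected away. -/
theorem balanced_mem_sigmaClass {n : ℕ} {t : Fin T} {Γ : Set X} (hΓ : Γ ∈ SigmaClass n X) :
    M.balanced t Γ ∈ SigmaClass n X := by
  classical
  let B (m : ℕ) : Set (X × (Fin m → X × ℝ≥0)) := {p |
    ((∀ i, (p.2 i).2 ≠ 0 ∧ M.traj t.castSucc (p.2 i).1 = M.traj t.castSucc p.1) ∧
      (∃ i, (p.2 i).1 = p.1)) ∧ ∑ i, (p.2 i).2 • M.increment t (p.2 i).1 = 0}
  have hB (m) : MeasurableSet (B m) := by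
    have hx (i : Fin m) : Measurable fun p : X × (Fin m → X × ℝ≥0) => (p.2 i).1 := by fun_prop
    have hw (i : Fin m) : Measurable fun p : X × (Fin m → X × ℝ≥0) => (p.2 i).2 := by fun_prop
    have hτ := M.measurable_traj t.castSucc
    have h1 : MeasurableSet {p : X × (Fin m → X × ℝ≥0) | ∀ i, (p.2 i).2 ≠ 0 ∧
        M.traj t.castSucc (p.2 i).1 = M.traj t.castSucc p.1} := by
      rw [Set.ofPred_forall]
      exact MeasurableSet.iInter fun i => (hw i (measurableSet_singleton 0)).compl.inter
        (measurableSet_eq_fun (hτ.comp (hx i)) (hτ.comp measurable_fst))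
    have h2 : MeasurableSet {p : X × (Fin m → X × ℝ≥0) | ∃ i, (p.2 i).1 = p.1} := by
      rw [Set.ofPred_exists]
      exact MeasurableSet.iUnion fun i => measurableSet_eq_fun (hx i) measurable_fst
    exact (h1.inter h2).inter (measurableSet_eq_fun (Finset.measurable_sum _ fun i _ =>
      (hw i).smul ((M.measurable_increment t).comp (hx i))) measurable_const)
  have hD (m) : (Prod.fst '' ((⋂ i, (fun p : X × (Fin m → X × ℝ≥0) => (p.2 i).1) ⁻¹' Γ) ∩ B m)) ∈
      SigmaClass n X :=
    SigmaClass.image_fst (SigmaClass.inter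
      (SigmaClass.iInter_fin fun i => SigmaClass.preimage n hΓ (by fun_prop))
      (SigmaClass.of_measurableSet n (hB m)))
  convert SigmaClass.iUnion hD using 1
  ext ω
  simp only [Set.mem_iUnion, Set.mem_image, Prod.exists, exists_and_right, exists_eq_right,
    Set.mem_inter_iff, Set.mem_iInter, Set.mem_preimage]
  constructor
  · rintro ⟨w, hw, hs, h0⟩
    let q := w.support.equivFin.symm
    refine ⟨w.support.card, fun i => (q i, w (q i)), fun i => (hs _ (q i).2).1,
      ⟨fun i => ⟨Finsupp.mem_support_iff.1 (q i).2, (hs _ (q i).2).2⟩, ?_⟩, ?_⟩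
    · exact ⟨q.symm ⟨ω, Finsupp.mem_support_iff.2 hw⟩, by simp⟩
    · rw [← h0, Finsupp.sum, ← Finset.sum_coe_sort w.support]
      exact q.sum_comp fun ω' => w ω' • M.increment t ω'
  · rintro ⟨m, f, hΓ', ⟨hf, ⟨i₀, hi₀⟩⟩, h0⟩
    refine ⟨∑ i, Finsupp.single (f i).1 (f i).2, ?_, ?_, ?_⟩
    · rw [Finsupp.finsetSum_apply, ← pos_iff_ne_zero]
      refine Finset.sum_pos' (fun _ _ => zero_le) ⟨i₀, Finset.mem_univ _, ?_⟩
      dsimp only at hi₀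
      rw [hi₀, Finsupp.single_eq_same]
      exact pos_iff_ne_zero.2 (hf i₀).1
    · intro ω' hω'
      obtain ⟨i, -, hi⟩ := Finsupp.mem_support_finsetSum _ hω'
      rw [Finset.mem_singleton.1 (Finsupp.support_single_subset hi)]
      exact ⟨hΓ' i, (hf i).2⟩
    · rw [← Finsupp.sum_finsetSum_index (by simp) (by intros; rw [add_smul]), ← h0]
      exact Finset.sum_congr rfl fun i _ => Finsupp.sum_single_index (by simp)

end Complexity

/-! ### Finitely supported martingale measures -/

theorem filtration_eq_comap (t : Fin (T + 1)) :
    M.filtration t = MeasurableSpace.comap (M.traj t) inferInstance :=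
  Filtration.natural_eq_comap _ _ t

theorem stronglyAdapted_S : StronglyAdapted M.filtration M.S := by
  intro t
  have h : Measurable[M.filtration t] (M.traj t) := by
    rw [filtration_eq_comap]
    exact comap_measurable _
  exact (measurable_fst.comp ((measurable_pi_apply (⟨t, Set.self_mem_Iic⟩ : Set.Iic t)).comp
    h)).stronglyMeasurable

theorem setIntegral_increment_eq_zero {Q : Measure X} [IsProbabilityMeasure Q]
    (hQ : Martingale M.S M.filtration Q) (t : Fin T) {C : Set _}
    (hC : MeasurableSet C) : ∫ ω in M.traj t.castSucc ⁻¹' C, M.increment t ω ∂Q = 0 := by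
  have hA : MeasurableSet[M.filtration t.castSucc] (M.traj t.castSucc ⁻¹' C) := by
    rw [filtration_eq_comap]
    exact ⟨C, hC, rfl⟩
  unfold increment
  rw [integral_sub (hQ.integrable _).integrableOn (hQ.integrable _).integrableOn,
    hQ.setIntegral_eq t.castSucc_lt_succ.le hA, sub_self]

theorem martingale_of_setIntegral_increment {Q : Measure X} [IsProbabilityMeasure Q]
    (hint : ∀ t, Integrable (M.S t) Q) (h : ∀ (t : Fin T) (C : Set _), MeasurableSet C →
      ∫ ω in M.traj t.castSucc ⁻¹' C, M.increment t ω ∂Q = 0) :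
    Martingale M.S M.filtration Q := by
  refine ⟨stronglyAdapted_S, fun i j hij => ?_⟩
  have key : ∀ j, i ≤ j → ∀ A, MeasurableSet[M.filtration i] A →
      ∫ ω in A, M.S i ω ∂Q = ∫ ω in A, M.S j ω ∂Q := by
    intro j
    induction j using Fin.induction with
    | zero =>
      intro h0 A _
      rw [Fin.le_zero_iff.1 h0]
    | succ t ih =>
      intro hi A hA
      rcases hi.eq_or_lt with rfl | hlt
      · rfl
      · have hle : i ≤ t.castSucc := Fin.le_castSucc_iff.2 hlt
        rw [ih hle A hA]
        have hA' := M.filtration.mono hle _ hA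
        rw [filtration_eq_comap] at hA'
        obtain ⟨C, hC, rfl⟩ := hA'
        have := h t C hC
        unfold increment at this
        rw [integral_sub (hint _).integrableOn (hint _).integrableOn, sub_eq_zero] at this
        exact this.symm
  exact (ae_eq_condExp_of_forall_setIntegral_eq (M.filtration.le i) (hint j)
    (fun _ _ _ => (hint i).integrableOn) (fun A hA _ => key j hij A hA)
    (stronglyAdapted_S i).aestronglyMeasurable).symm

/-- A weighting of finitely many scenarios under which `S` is a martingale from time `t` on, up to
normalization. The function `g` tests against all events of the past. -/
def IsMartingaleFrom (M : Market X T d e) (t : Fin (T + 1)) (w : X →₀ ℝ≥0) : Prop :=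
  ∀ s : Fin T, t ≤ s.castSucc → ∀ g : (Set.Iic s.castSucc →
    EuclideanSpace ℝ (Fin d) × EuclideanSpace ℝ (Fin e)) → ℝ,
    Finsupp.linearCombination ℝ≥0 (fun ω => g (M.traj s.castSucc ω) • M.increment s ω) w = 0

section Forward

variable {Ω : Set X} {A : Fin (T + 1) → Set X}

/-- A scenario that survives down to time `t` is charged by a finite martingale weighting started
at time `t`: the weightings started at time `t + 1` from the scenarios of a balanced weighting are
glued. -/
theorem exists_isMartingaleFrom (hlast : A (Fin.last T) = Ω)
    (hA : ∀ t : Fin T, A t.castSucc = M.balanced t (A t.succ)) (t : Fin (T + 1)) :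
    ∀ ω ∈ A t, ∃ w : X →₀ ℝ≥0, w ω ≠ 0 ∧
      (∀ ω' ∈ w.support, ω' ∈ Ω ∧ M.traj t ω' = M.traj t ω) ∧ M.IsMartingaleFrom t w := by
  classical
  induction t using Fin.reverseInduction with
  | last =>
    intro ω hω
    refine ⟨Finsupp.single ω 1, by simp, fun ω' hω' => ?_, fun s hs => ?_⟩
    · rw [Finset.mem_singleton.1 (Finsupp.support_single_subset hω'), ← hlast]
      exact ⟨hω, rfl⟩
    · exact absurd hs (not_le.2 s.castSucc_lt_last)
  | cast t ih =>
    intro ω hω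
    rw [hA] at hω
    obtain ⟨w, hw, hs, h0⟩ := hω
    choose! v hv hvs hvm using ih
    let mass (ω' : X) : ℝ≥0 := Finsupp.linearCombination ℝ≥0 (fun _ => (1 : ℝ≥0)) (v ω')
    have hmass {ω'} (h : ω' ∈ A t.succ) : mass ω' ≠ 0 := by
      have : mass ω' = ∑ x ∈ (v ω').support, v ω' x := by
        simp [mass, Finsupp.linearCombination_apply, Finsupp.sum]
      rw [this, ← pos_iff_ne_zero]
      exact Finset.sum_pos' (fun _ _ => zero_le)
        ⟨ω', Finsupp.mem_support_iff.2 (hv ω' h), pos_iff_ne_zero.2 (hv ω' h)⟩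
    have hωs := Finsupp.mem_support_iff.2 hw
    refine ⟨∑ ω' ∈ w.support, (w ω' / mass ω') • v ω', ?_, fun x hx => ?_, fun s hts g => ?_⟩
    · rw [Finsupp.finsetSum_apply, ← pos_iff_ne_zero]
      refine Finset.sum_pos' (fun _ _ => zero_le) ⟨ω, hωs, ?_⟩
      rw [Finsupp.smul_apply, smul_eq_mul]
      have h1 := (hs ω hωs).1
      exact mul_pos (div_pos (pos_iff_ne_zero.2 hw) (pos_iff_ne_zero.2 (hmass h1)))
        (pos_iff_ne_zero.2 (hv ω h1))
    · obtain ⟨ω', hω', hx'⟩ := Finsupp.mem_support_finsetSum _ hx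
      have h1 := hvs ω' (hs ω' hω').1 x (Finsupp.support_smul hx')
      exact ⟨h1.1, (traj_eq_of_le t.castSucc_lt_succ.le h1.2).trans (hs ω' hω').2⟩
    · simp only [map_sum, map_smul]
      rcases hts.eq_or_lt with heq | hlt
      · obtain rfl := Fin.castSucc_injective _ heq
        -- Over the period from `t`, each glued weighting acts as a point mass.
        have h1 : ∀ ω' ∈ w.support, (w ω' / mass ω') • Finsupp.linearCombination ℝ≥0
            (fun x => g (M.traj t.castSucc x) • M.increment t x) (v ω') =
            g (M.traj t.castSucc ω) • (w ω' • M.increment t ω') := by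
          intro ω' hω'
          have h2 := (hs ω' hω').1
          have h3 : Finsupp.linearCombination ℝ≥0
              (fun x => g (M.traj t.castSucc x) • M.increment t x) (v ω') =
              mass ω' • (g (M.traj t.castSucc ω) • M.increment t ω') := by
            simp only [mass, Finsupp.linearCombination_apply, Finsupp.sum, smul_eq_mul, mul_one,
              Finset.sum_smul]
            refine Finset.sum_congr rfl fun x hx => ?_
            have h4 := (hvs ω' h2 x hx).2
            rw [increment_eq_of_traj_eq h4, traj_eq_of_le t.castSucc_lt_succ.le h4,
              (hs ω' hω').2]
          rw [h3, smul_smul, div_mul_cancel₀ _ (hmass h2), smul_comm]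
        have h0' : ∑ ω' ∈ w.support, w ω' • M.increment t ω' = 0 := h0
        rw [Finset.sum_congr rfl h1, ← Finset.smul_sum, h0', smul_zero]
      · have hle : t.succ ≤ s.castSucc := Fin.castSucc_lt_iff_succ_le.1 hlt
        exact Finset.sum_eq_zero fun ω' hω' => by
          rw [hvm ω' (hs ω' hω').1 s hle g, smul_zero]

end Forward

section WeightMeasure

variable [MeasurableSingletonClass X]

/-- The measure that puts mass `w ω` on each scenario `ω`. -/
noncomputable def weightMeasure (w : X →₀ ℝ≥0) : Measure X :=
  ∑ ω ∈ w.support, w ω • Measure.dirac ω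

theorem weightMeasure_apply (w : X →₀ ℝ≥0) (s : Set X) :
    weightMeasure w s = ∑ ω ∈ w.support, (w ω : ENNReal) * s.indicator 1 ω := by
  rw [weightMeasure, Measure.finsetSum_apply]
  exact Finset.sum_congr rfl fun ω _ => by
    rw [Measure.smul_apply, Measure.dirac_apply, ENNReal.smul_def, smul_eq_mul]

theorem weightMeasure_compl_eq_zero {w : X →₀ ℝ≥0} {s : Set X} (hs : ∀ ω ∈ w.support, ω ∈ s) :
    weightMeasure w sᶜ = 0 := by
  rw [weightMeasure_apply]
  exact Finset.sum_eq_zero fun ω hω => by simp [hs ω hω]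

theorem integrable_weightMeasure (w : X →₀ ℝ≥0) {E : Type*} [NormedAddCommGroup E] (f : X → E) :
    Integrable f (weightMeasure w) :=
  integrable_finsetSum_measure.2 fun ω _ =>
    (integrable_dirac (by simp)).smul_measure_nnreal

theorem integral_weightMeasure (w : X →₀ ℝ≥0) {E : Type*} [NormedAddCommGroup E]
    [NormedSpace ℝ E] [CompleteSpace E] (f : X → E) :
    ∫ ω, f ω ∂weightMeasure w = Finsupp.linearCombination ℝ≥0 f w := by
  rw [weightMeasure, integral_finsetSum_measure fun ω _ =>
    (integrable_dirac (by simp)).smul_measure_nnreal, Finsupp.linearCombination_apply]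
  exact Finset.sum_congr rfl fun ω _ => by
    rw [integral_smul_nnreal_measure, integral_dirac]

end WeightMeasure

section Star

variable [TopologicalSpace X] [PolishSpace X] [BorelSpace X]
  {Ω : Set X} {A : Fin (T + 1) → Set X}

theorem mem_star_of_isMartingaleFrom {ω : X} {w : X →₀ ℝ≥0} (hω : w ω ≠ 0)
    (hs : ∀ ω' ∈ w.support, ω' ∈ Ω) (hm : M.IsMartingaleFrom 0 w) : ω ∈ M.star Ω := by
  have hωs := Finsupp.mem_support_iff.2 hω
  have hpos : 0 < ∑ x ∈ w.support, w x :=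
    Finset.sum_pos' (fun _ _ => zero_le) ⟨ω, hωs, pos_iff_ne_zero.2 hω⟩
  set c : ℝ≥0 := ∑ x ∈ w.support, w x
  set v : X →₀ ℝ≥0 := c⁻¹ • w with hv
  have hsupp : v.support = w.support := Finsupp.support_smul_eq (inv_ne_zero hpos.ne')
  have hvs : ∀ ω' ∈ v.support, ω' ∈ Ω := hsupp ▸ hs
  have hprob : IsProbabilityMeasure (weightMeasure v) := by
    refine ⟨?_⟩
    rw [weightMeasure_apply, hsupp]
    simp only [Set.indicator_univ, Pi.one_apply, mul_one]
    rw [← ENNReal.ofNNReal_finsetSum]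
    simp only [hv, Finsupp.smul_apply, smul_eq_mul, ← Finset.mul_sum]
    rw [inv_mul_cancel₀ hpos.ne', ENNReal.coe_one]
  refine ⟨hs ω hωs, weightMeasure v, ⟨⟨hprob, ?_, weightMeasure_compl_eq_zero hvs⟩, ?_⟩, ?_⟩
  · refine martingale_of_setIntegral_increment (fun t => integrable_weightMeasure _ _)
      fun t C hC => ?_
    have hmeas : MeasurableSet (M.traj t.castSucc ⁻¹' C) := M.measurable_traj _ hC
    rw [← integral_indicator hmeas, integral_weightMeasure, hv, map_smul]
    have hF : (M.traj t.castSucc ⁻¹' C).indicator (M.increment t) =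
        fun ω' => C.indicator (fun _ => (1 : ℝ)) (M.traj t.castSucc ω') • M.increment t ω' := by
      ext1 ω'
      by_cases h : M.traj t.castSucc ω' ∈ C
      · rw [Set.indicator_of_mem h,
          Set.indicator_of_mem (show ω' ∈ M.traj t.castSucc ⁻¹' C from h), one_smul]
      · rw [Set.indicator_of_notMem h,
          Set.indicator_of_notMem (show ω' ∉ M.traj t.castSucc ⁻¹' C from h), zero_smul]
    rw [hF, hm t (Fin.zero_le _), smul_zero]
  · refine (Finset.finite_toSet v.support).subset
      (Measure.support_subset_of_isClosed (Finset.finite_toSet _).isClosed ?_)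
    exact weightMeasure_compl_eq_zero fun ω' h => h
  · rw [weightMeasure_apply]
    refine lt_of_lt_of_le ?_ (Finset.single_le_sum (f := fun x =>
      (v x : ENNReal) * Set.indicator {ω} 1 x) (fun _ _ => zero_le) (hsupp ▸ hωs))
    simp [pos_iff_ne_zero, hv, hω, hpos.ne']

/-- The atoms of a martingale measure with finite support, as a weighting. -/
theorem exists_finsupp_of_finite_support {Q : Measure X} [IsProbabilityMeasure Q]
    (hfin : Q.support.Finite) : ∃ w : X →₀ ℝ≥0, (∀ ω, w ω = (Q {ω}).toNNReal) ∧
      ∀ f : X → EuclideanSpace ℝ (Fin d), ∫ ω, f ω ∂Q = Finsupp.linearCombination ℝ≥0 f w := by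
  have hmem (ω : X) (h : (Q {ω}).toNNReal ≠ 0) : ω ∈ hfin.toFinset := by
    rw [Set.Finite.mem_toFinset]
    by_contra hω
    apply h
    rw [measure_mono_null (Set.singleton_subset_iff.2 hω) Measure.measure_compl_support]
    rfl
  refine ⟨Finsupp.onFinset hfin.toFinset (fun ω => (Q {ω}).toNNReal) hmem, fun ω => rfl,
    fun f => ?_⟩
  rw [Finsupp.linearCombination_onFinset]
  have hae : ∀ᵐ ω ∂Q, ω ∈ (hfin.toFinset : Set X) := by
    rw [Set.Finite.coe_toFinset]
    exact Measure.support_mem_ae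
  have h := setIntegral_finset hfin.toFinset (f := f) (μ := Q) IntegrableOn.finset
  rw [Measure.restrict_eq_self_of_ae_mem hae] at h
  exact h

/-- If `A` is obtained from `Ω` by passing backward to the balanced scenarios, then the scenarios
in `A 0` are those charged by finitely supported martingale measures on `Ω`. -/
theorem star_eq_of_balanced (hlast : A (Fin.last T) = Ω)
    (hA : ∀ t : Fin T, A t.castSucc = M.balanced t (A t.succ)) : M.star Ω = A 0 := by
  classical
  ext ω
  constructor
  · rintro ⟨-, Q, ⟨⟨hprob, hmart, hQ⟩, hfin⟩, hpos⟩
    obtain ⟨w, hw, hint⟩ := exists_finsupp_of_finite_support (d := d) hfin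
    have hne {x : X} : x ∈ w.support ↔ Q {x} ≠ 0 := by
      rw [Finsupp.mem_support_iff, hw, Ne, ENNReal.toNNReal_eq_zero_iff]
      simp
    have key (t : Fin (T + 1)) : ∀ x ∈ w.support, x ∈ A t := by
      induction t using Fin.reverseInduction with
      | last =>
        intro x hx
        rw [hlast]
        by_contra hxΩ
        exact hne.1 hx (measure_mono_null (Set.singleton_subset_iff.2 hxΩ) hQ)
      | cast t ih =>
        intro x hx
        rw [hA]
        refine ⟨w.filter fun y => M.traj t.castSucc y = M.traj t.castSucc x, ?_, fun y hy => ?_, ?_⟩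
        · rw [Finsupp.filter_apply_pos (fun y => M.traj t.castSucc y = M.traj t.castSucc x) _ rfl]
          exact Finsupp.mem_support_iff.1 hx
        · rw [Finsupp.support_filter, Finset.mem_filter] at hy
          exact ⟨ih y hy.1, hy.2⟩
        · have h0 := setIntegral_increment_eq_zero hmart t
            (measurableSet_singleton (M.traj t.castSucc x))
          rw [← integral_indicator (M.measurable_traj _ (measurableSet_singleton _)), hint,
            Finsupp.linearCombination_apply, Finsupp.sum] at h0
          rw [← h0, Finsupp.sum, Finsupp.support_filter, Finset.sum_filter]
          refine Finset.sum_congr rfl fun y _ => ?_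
          by_cases hy : M.traj t.castSucc y = M.traj t.castSucc x
          · rw [if_pos hy, Finsupp.filter_apply_pos
              (fun y => M.traj t.castSucc y = M.traj t.castSucc x) _ hy, Set.indicator_of_mem
              (show y ∈ M.traj t.castSucc ⁻¹' {M.traj t.castSucc x} from hy)]
          · rw [if_neg hy, Set.indicator_of_notMem
              (show y ∉ M.traj t.castSucc ⁻¹' {M.traj t.castSucc x} from hy), smul_zero]
    exact key 0 ω (hne.2 hpos.ne')
  · intro hω
    obtain ⟨w, hw, hs, hm⟩ := exists_isMartingaleFrom hlast hA 0 ω hω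
    exact mem_star_of_isMartingaleFrom hw (fun ω' h => (hs ω' h).1) hm

end Star

end Market

/-! ### Arbitrary martingale measures -/

namespace Market

variable {X : Type u} [TopologicalSpace X] [PolishSpace X] [MeasurableSpace X] [BorelSpace X]
  {T d e : ℕ} {M : Market X T d e}

/-- A martingale measure concentrated on a Borel set is concentrated on a Borel set of balanced
scenarios: those whose increment belongs to the topological support of its conditional law given
the past. The part of a set of full conditional measure on which the increment lies in
this support is arbitrage-free, since the conditional mean of the increment vanishes. -/
theorem exists_measurableSet_subset_balanced {Q : Measure X} [IsProbabilityMeasure Q]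
    (hQ : Martingale M.S M.filtration Q) (t : Fin T) {R : Set X} (hR : MeasurableSet R)
    (hQR : ∀ᵐ ω ∂Q, ω ∈ R) :
    ∃ R', MeasurableSet R' ∧ (∀ᵐ ω ∂Q, ω ∈ R') ∧ R' ⊆ M.balanced t R := by
  have : Nonempty X := nonempty_of_isProbabilityMeasure Q
  set τ := M.traj t.castSucc
  have hτ : Measurable τ := M.measurable_traj _
  set f := M.increment t
  have hf : Measurable f := M.measurable_increment t
  have hfint : Integrable f Q := (hQ.integrable _).sub (hQ.integrable _)
  set ν := Q.map τ
  have : IsProbabilityMeasure ν := Measure.isProbabilityMeasure_map hτ.aemeasurable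
  set κ := ProbabilityTheory.condDistrib id τ Q
  have hg : Measurable fun ω => (τ ω, ω) := hτ.prodMk measurable_id
  have hκ : ν.compProd κ = Q.map fun ω => (τ ω, ω) :=
    ProbabilityTheory.compProd_map_condDistrib aemeasurable_id
  -- The conditional laws live on the fibres, intersected with `R`.
  have h1 : ∀ᵐ x ∂ν, ∀ᵐ ω ∂κ x, τ ω = x ∧ ω ∈ R := by
    refine Measure.ae_ae_of_ae_compProd (p := fun p => τ p.2 = p.1 ∧ p.2 ∈ R) ?_
    have hm : MeasurableSet {p : _ × X | τ p.2 = p.1 ∧ p.2 ∈ R} :=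
      (measurableSet_eq_fun (hτ.comp measurable_snd) measurable_fst).inter (measurable_snd hR)
    rw [hκ, ae_map_iff hg.aemeasurable hm]
    filter_upwards [hQR] with ω hω using ⟨rfl, hω⟩
  -- The increment is conditionally integrable with conditional mean zero.
  have hFint : Integrable (fun p : _ × X => f p.2) (ν.compProd κ) := by
    rw [hκ]
    exact (integrable_map_measure (hf.comp measurable_snd).aestronglyMeasurable
      hg.aemeasurable).2 hfint
  have h2 : ∀ᵐ x ∂ν, Integrable f (κ x) :=
    ((Measure.integrable_compProd_iff hFint.aestronglyMeasurable).1 hFint).1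
  have h3 : ∀ᵐ x ∂ν, ∫ ω, f ω ∂κ x = 0 := by
    have hmean : Integrable (fun x => ∫ ω, f ω ∂κ x) ν := by
      simpa using Integrable.integral_compProd (κ := ProbabilityTheory.Kernel.const Unit ν)
        (η := ProbabilityTheory.Kernel.prodMkLeft Unit κ) (a := ()) hFint
    refine Integrable.ae_eq_zero_of_forall_setIntegral_eq_zero hmean fun C hC _ => ?_
    have h := Measure.setIntegral_compProd hC MeasurableSet.univ hFint.integrableOn
    simp only [Measure.restrict_univ] at h
    rw [← h, hκ]
    refine (setIntegral_map (hC.prod MeasurableSet.univ)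
      (hf.comp measurable_snd).aestronglyMeasurable hg.aemeasurable).trans ?_
    have hpre : (fun ω => (τ ω, ω)) ⁻¹' (C ×ˢ Set.univ) = τ ⁻¹' C := by
      ext ω
      simp
    rw [hpre]
    exact setIntegral_increment_eq_zero hQ t hC
  obtain ⟨G, hG, hGm, hGgood⟩ := (h1.and (h2.and h3)).exists_measurable_mem
  set b := TopologicalSpace.countableBasis (EuclideanSpace ℝ (Fin d))
  have hb := TopologicalSpace.isBasis_countableBasis (EuclideanSpace ℝ (Fin d))
  have hbc : b.Countable := TopologicalSpace.countable_countableBasis _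
  have hκU (U : Set (EuclideanSpace ℝ (Fin d))) (hU : U ∈ b) :
      Measurable fun x => κ x (f ⁻¹' U) :=
    ProbabilityTheory.Kernel.measurable_coe κ (hf (hb.isOpen hU).measurableSet)
  -- The pairs of a past and an increment which is not in the support of the conditional law.
  let N (U : Set (EuclideanSpace ℝ (Fin d))) : Set (_ × X) := {p | f p.2 ∈ U ∧ κ p.1 (f ⁻¹' U) = 0}
  have hN (U) (hU : U ∈ b) : MeasurableSet (N U) :=
    (hf.comp measurable_snd (hb.isOpen hU).measurableSet).inter
      ((hκU U hU).comp measurable_fst (measurableSet_singleton 0))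
  have hNx (x) : ∀ᵐ ω ∂κ x, ∀ U ∈ b, (x, ω) ∉ N U := by
    rw [ae_ball_iff hbc]
    intro U hU
    by_cases h0 : κ x (f ⁻¹' U) = 0
    · have : ∀ᵐ ω ∂κ x, ω ∉ f ⁻¹' U := measure_eq_zero_iff_ae_notMem.1 h0
      filter_upwards [this] with ω hω h using hω h.1
    · exact Filter.Eventually.of_forall fun ω h => h0 h.2
  let R' : Set X := {ω | (ω ∈ R ∧ τ ω ∈ G) ∧ ∀ U ∈ b, (τ ω, ω) ∉ N U}
  refine ⟨R', ?_, ?_, ?_⟩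
  · refine (hR.inter (hτ hGm)).inter ?_
    have : {ω | ∀ U ∈ b, (τ ω, ω) ∉ N U} = ⋂ U ∈ b, (fun ω => (τ ω, ω)) ⁻¹' (N U)ᶜ := by
      ext ω
      simp
    change MeasurableSet {ω | ∀ U ∈ b, (τ ω, ω) ∉ N U}
    rw [this]
    exact MeasurableSet.biInter hbc fun U hU => hg (hN U hU).compl
  · have h4 : ∀ᵐ ω ∂Q, τ ω ∈ G := ae_of_ae_map hτ.aemeasurable hG
    have h5 : ∀ᵐ ω ∂Q, ∀ U ∈ b, (τ ω, ω) ∉ N U := by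
      rw [ae_ball_iff hbc]
      intro U hU
      refine ae_of_ae_map hg.aemeasurable (p := fun p => p ∉ N U) ?_
      rw [← hκ]
      refine Measure.ae_compProd_of_ae_ae (hN U hU).compl (Filter.Eventually.of_forall fun x => ?_)
      filter_upwards [hNx x] with ω hω using hω U hU
    filter_upwards [hQR, h4, h5] with ω a1 a2 a3 using ⟨⟨a1, a2⟩, a3⟩
  · intro ω hω
    refine balanced_mono (Γ := R') (fun _ h => h.1.1) (mem_balanced_of_noArbitrage hω ?_)
    obtain ⟨g1, g2, g3⟩ := hGgood _ hω.1.2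
    have hfull : ∀ᵐ ω' ∂κ (τ ω), ω' ∈ R' ∧ τ ω' = τ ω := by
      filter_upwards [g1, hNx (τ ω)] with ω' a1 a2
      refine ⟨⟨⟨a1.2, ?_⟩, ?_⟩, a1.1⟩ <;> rw [a1.1]
      exacts [hω.1.2, a2]
    intro h hh
    have hnn : 0 ≤ᵐ[κ (τ ω)] fun ω' => inner ℝ h (f ω') := by
      filter_upwards [hfull] with ω' hω' using hh _ ⟨ω', hω', rfl⟩
    have hz : (fun ω' => inner ℝ h (f ω')) =ᵐ[κ (τ ω)] 0 := by
      rw [← integral_eq_zero_iff_of_nonneg_ae hnn (g2.const_inner h), integral_inner g2, g3,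
        inner_zero_right]
    rintro _ ⟨ω', ⟨hω', hτω'⟩, rfl⟩
    refine le_antisymm (not_lt.1 fun hpos => ?_) (hh _ ⟨ω', ⟨hω', hτω'⟩, rfl⟩)
    have hopen : IsOpen {k : EuclideanSpace ℝ (Fin d) | 0 < inner ℝ h k} :=
      isOpen_lt continuous_const (by fun_prop)
    obtain ⟨U, hU, hmem, hsub⟩ := hb.exists_subset_of_mem_open hpos hopen
    refine hω'.2 U hU ⟨hmem, measure_eq_zero_iff_ae_notMem.2 ?_⟩
    change ∀ᵐ y ∂κ (τ ω'), y ∉ f ⁻¹' U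
    rw [show τ ω' = τ ω from hτω']
    filter_upwards [hz] with y hy hyU
    exact (hsub hyU).ne' hy

/-- No regularity of `Ω` is needed: a set of full measure for the completion contains a Borel set of
full measure. -/
theorem nonempty_of_martingaleMeasures {Ω : Set X} {A : Fin (T + 1) → Set X}
    (hlast : A (Fin.last T) = Ω) (hA : ∀ t : Fin T, A t.castSucc = M.balanced t (A t.succ))
    (h : (M.martingaleMeasures Ω).Nonempty) : (A 0).Nonempty := by
  obtain ⟨Q, hprob, hmart, hQ⟩ := h
  have key (t : Fin (T + 1)) : ∃ R, MeasurableSet R ∧ (∀ᵐ ω ∂Q, ω ∈ R) ∧ R ⊆ A t := by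
    induction t using Fin.reverseInduction with
    | last =>
      refine ⟨(toMeasurable Q Ωᶜ)ᶜ, (measurableSet_toMeasurable _ _).compl, ?_, ?_⟩
      · exact measure_eq_zero_iff_ae_notMem.1 (by rw [measure_toMeasurable, hQ])
      · rw [hlast]
        exact Set.compl_subset_comm.1 (subset_toMeasurable _ _)
    | cast t ih =>
      obtain ⟨R, hR, hQR, hRA⟩ := ih
      obtain ⟨R', hR', hQR', hsub⟩ := exists_measurableSet_subset_balanced hmart t hR hQR
      exact ⟨R', hR', hQR', hA t ▸ hsub.trans (balanced_mono hRA)⟩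
  obtain ⟨R, -, hQR, hRA⟩ := key 0
  obtain ⟨ω, hω⟩ := hQR.exists
  exact ⟨ω, hRA hω⟩

end Market

/-! ### The backward scheme -/

namespace Market

variable {X : Type u} [MeasurableSpace X] {T d e : ℕ}

/-- The sequence obtained from `Ω` by passing backward in time to the balanced scenarios. -/
def balancedSeq (M : Market X T d e) (Ω : Set X) : Fin (T + 1) → Set X :=
  Fin.reverseInduction (motive := fun _ => Set X) Ω fun t Γ => M.balanced t Γ

variable {M : Market X T d e} {Ω : Set X}

theorem balancedSeq_last : M.balancedSeq Ω (Fin.last T) = Ω :=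
  Fin.reverseInduction_last

theorem balancedSeq_castSucc (t : Fin T) :
    M.balancedSeq Ω t.castSucc = M.balanced t (M.balancedSeq Ω t.succ) :=
  Fin.reverseInduction_castSucc _

variable [TopologicalSpace X] [PolishSpace X] [BorelSpace X]

theorem balancedSeq_mem_sigmaClass {n : ℕ} (hΩ : Ω ∈ SigmaClass n X) (t : Fin (T + 1)) :
    M.balancedSeq Ω t ∈ SigmaClass n X := by
  induction t using Fin.reverseInduction with
  | last => rwa [balancedSeq_last]
  | cast t ih =>
    rw [balancedSeq_castSucc]
    exact balanced_mem_sigmaClass ih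

theorem isBackwardScheme_balancedSeq (hΩ : IsProjective Ω) :
    M.IsBackwardScheme Ω (M.balancedSeq Ω) := by
  refine ⟨balancedSeq_last, fun t => ?_⟩
  obtain ⟨n, hn⟩ := hΩ
  obtain ⟨C⟩ := nonempty_condSplitting (M := M) t ⟨n, balancedSeq_mem_sigmaClass hn t.succ⟩
  exact ⟨C, by rw [C.diff_eq_balanced, balancedSeq_castSucc]⟩

theorem IsBackwardScheme.star_eq {A : Fin (T + 1) → Set X} (hA : M.IsBackwardScheme Ω A) :
    M.star Ω = A 0 :=
  star_eq_of_balanced hA.1 fun t => by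
    obtain ⟨C, hC⟩ := hA.2 t
    rw [hC, C.diff_eq_balanced]

end Market

theorem mainTheorem8 {X : Type u} [TopologicalSpace X] [PolishSpace X] [MeasurableSpace X]
    [BorelSpace X] (T d e : ℕ) (M : Market X T d e) (Ω : Set X) (hΩ : IsProjective Ω) :
    (∃ A : Fin (T + 1) → Set X, M.IsBackwardScheme Ω A) ∧
    (∀ A : Fin (T + 1) → Set X, M.IsBackwardScheme Ω A → M.star Ω = A 0) ∧
    IsProjective (M.star Ω) ∧
    (AnalyticSet Ω →
      AnalyticSet (M.star Ω) ∧
      ((M.star Ω).Nonempty ↔ (M.martingaleMeasures Ω).Nonempty) ∧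
      ((M.martingaleMeasures Ω).Nonempty ↔ (M.finMartingaleMeasures Ω).Nonempty)) := by
  have hstar : M.star Ω = M.balancedSeq Ω 0 :=
    Market.star_eq_of_balanced Market.balancedSeq_last Market.balancedSeq_castSucc
  have hfin (h : (M.star Ω).Nonempty) : (M.finMartingaleMeasures Ω).Nonempty := by
    obtain ⟨ω, -, Q, hQ, -⟩ := h
    exact ⟨Q, hQ⟩
  have hmart (h : (M.finMartingaleMeasures Ω).Nonempty) : (M.martingaleMeasures Ω).Nonempty :=
    h.mono fun _ hQ => hQ.1
  have hne (h : (M.martingaleMeasures Ω).Nonempty) : (M.star Ω).Nonempty :=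
    hstar ▸ Market.nonempty_of_martingaleMeasures Market.balancedSeq_last
      Market.balancedSeq_castSucc h
  refine ⟨⟨_, Market.isBackwardScheme_balancedSeq hΩ⟩, fun A hA => hA.star_eq, ?_, fun han =>
    ⟨?_, ⟨fun h => hmart (hfin h), hne⟩, ⟨fun h => hfin (hne h), hmart⟩⟩⟩
  · obtain ⟨n, hn⟩ := hΩ
    exact ⟨n, hstar ▸ Market.balancedSeq_mem_sigmaClass hn 0⟩
  · rw [hstar]
    exact Market.balancedSeq_mem_sigmaClass (n := 0) han 0
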